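/- **Setting.** Let $S$ be a system of $P$ exchangeable particles in $\mathbb R^d$, $$dX_{p|P}=a(t,X_{p|P},\mu_{X_P(t)})\,dt+\sigma(t,X_{p|P},\mu_{X_P(t)})\,dW_p,\qquad X_{p|P}(0)=x_p^0,$$ where $\mu_{X_P(t)}$ is the empirical measure of the particles, $a$ and $\sigma$ may also depend on a random parameter $\vartheta_p$, the inputs $\omega_p=(x_p^0,\vartheta_p,W_p)$, $p\ge1$, are i.i.d., and the Wiener process $W_p$ is independent of $(x_p^0,\vartheta_p)$. Let $X_\infty$ be a weak solution of the limiting McKean–Vlasov equation $dX_\infty=a(t,X_\infty,\mathrm{law}\,X_\infty(t))\,dt+\sigma(t,X_\infty,\mathrm{law}\,X_\infty(t))\,dW$, and let $\phi_\infty=\mathbb E[\psi(X_\infty(T))]$, $0<T<\infty$, with $\psi(X_\infty(T))$ integrable. For a one-step time-stepping scheme with $N$ uniform steps on $[0,T]$ let $\phi_P^N(\omega_{1:P})=\frac1P\sum_{p=1}^P\psi(X^{N|N}_{p|P})$. Fix an integer $\beta\ge2$ ($=\beta_P=\beta_N$), $P_{\alpha_1}=\beta^{\alpha_1}$, $N_{\alpha_2}=\beta^{\alpha_2}$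 for $\alpha\in\mathbb N^2$ (with $0\in\mathbb N$). A *sampler* consists of square-integrable functions $\varphi_{P_\ell}^{N}(\omega_{1:P_{\ell+1}})$ with $\mathbb E\varphi_{P_\ell}^N=\mathbb E\phi_{P_\ell}^N$; the *partitioning sampler* splits the $P_{\ell+1}$ inputs into $\beta$ consecutive groups of size $P_\ell$, evaluates $\phi_{P_\ell}^N$ on each group and averages. The mixed difference is $$\Delta\phi_\alpha=(\phi_{P_{\alpha_1}}^{N_{\alpha_2}}-\varphi_{P_{\alpha_1-1}}^{N_{\alpha_2}})-(\phi_{P_{\alpha_1}}^{N_{\alpha_2-1}}-\varphi_{P_{\alpha_1-1}}^{N_{\alpha_2-1}})$$ (terms with index $-1$ are $0$), and for a finite $\mathcal I\subset\mathbb N^2$ and sample numbers $M_\alpha\ge1$ $$\mathcal A=\sum_{\alpha\in\mathcal I}\frac1{M_\alpha}\sum_{m=1}^{M_\alpha}\Delta\phi_\alpha(\omega^{(\alpha,m)}_{1:P_{\alpha_1}}),\qquad \mathrm{Work}(\mathcal A)=\sum_{\alpha\in\mathcal I}M_\alpha W_\alpha,$$ where all $\omega^{(\alpha,m)}_q$ are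 independent and $W_\alpha\ge 0$ is the work per sample of $\Delta\phi_\alpha$. Let $\gamma_P\ge1$, $0\le s_P\le1$, $0<s_N\le2$, and put $$\mathcal I(L)=\{\alpha\in\mathbb N^2:(1-s_P+\gamma_P)\alpha_1+(3-s_N)\alpha_2\le L\},$$ $$\zeta=\max\Big(\frac{\gamma_P-s_P-1}2,\frac{1-s_N}2\Big),\quad \xi=\min\Big(\frac{2-s_P}{\gamma_P},2-s_N\Big),\quad \mathfrak z=\begin{cases}1&\gamma_P-s_P-1\ne1-s_N\\2&\gamma_P-s_P-1=1-s_N,\end{cases}$$ $$\mathfrak p=\begin{cases}0&\zeta<0\\2\mathfrak z&\zeta=0\\2(\mathfrak z-1)(\zeta+1)&\zeta>0,\ \xi>0\\1+2(\mathfrak z-1)(\zeta+1)&\zeta>0,\ \xi=0.\end{cases}$$ **(a) Optimal index set.** Let $c_1,c_2,c_3>0$ and measure the error contribution, variance and work per sample at $\alpha$ by $e_\alpha=c_1P_{\alpha_1}^{-1}N_{\alpha_2}^{-1}$, $v_\alpha=c_2P_{\alpha_1}^{-s_P-1}N_{\alpha_2}^{-s_N}$, $w_\alpha=c_3P_{\alpha_1}^{\gamma_P}N_{\alpha_2}$.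 For every $L>0$ the set $\mathcal I(L)$ is finite, and it is uniquely optimal at its accuracy: if $J\ne\mathcal I(L)$ is a finite index set with $\sum_{\alpha\notin J}e_\alpha\le\sum_{\alpha\notin\mathcal I(L)}e_\alpha$, and $M_\alpha>0$ ($\alpha\in J$) are real sample numbers with $\sum_{\alpha\in J}v_\alpha/M_\alpha\le v$ for some $v>0$, then there are real $M'_\alpha>0$ ($\alpha\in\mathcal I(L)$) with $\sum_{\alpha\in\mathcal I(L)}v_\alpha/M'_\alpha\le v$ and $\sum_{\alpha\in\mathcal I(L)}M'_\alpha w_\alpha<\sum_{\alpha\in J}M_\alpha w_\alpha$. **(b) Complexity.** Assume that the $\phi_{P_{\alpha_1}}^{N_{\alpha_2}}$ are square integrable with $\mathbb E\phi_{P_{\alpha_1}}^{N_{\alpha_2}}\to\phi_\infty$ as $\alpha_1,\alpha_2\to\infty$, and that, with constants independent of $\alpha$, $$(\mathrm{MIMC1})\ |\mathbb E\Delta\phi_\alpha|\lesssim P_{\alpha_1}^{-1}N_{\alpha_2}^{-1},\quad(\mathrm{MIMC2})\ \operatorname{Var}\Delta\phi_\alpha\lesssim P_{\alpha_1}^{-s_P-1}N_{\alpha_2}^{-s_N},\quad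 W_\alpha\lesssim P_{\alpha_1}^{\gamma_P}N_{\alpha_2}.$$ Then for all $\epsilon\in(0,1)$, $C_\epsilon>0$, $\theta_0>0$ there is a constant $K$ such that for all $0<\mathrm{tol}<e^{-1}$ and $\theta\in[\theta_0,1-\theta_0]$ there are $L>0$ and integers $M_\alpha\ge1$ for which the estimator $\mathcal A$ with $\mathcal I=\mathcal I(L)$ is square integrable and satisfies $|\mathbb E\mathcal A-\phi_\infty|\le(1-\theta)\mathrm{tol}$, $\operatorname{Var}\mathcal A\le(\theta\,\mathrm{tol}/C_\epsilon)^2$, $\mathbb P(|\mathcal A-\mathbb E\mathcal A|\ge\theta\,\mathrm{tol})\le\epsilon$, $\mathbb P(|\mathcal A-\phi_\infty|\ge\mathrm{tol})\le\epsilon$, and $$\mathrm{Work}(\mathcal A)\le K\,\mathrm{tol}^{-2-2\max(0,\zeta)}\log(\mathrm{tol}^{-1})^{\mathfrak p}.$$ **(c) Naive cost.** Let the partitioning sampler be used, let one sample of $\phi_P^N$ cost $O(NP^2)$, and let $W_\alpha$ be the sum of the costs of the systems simulated for $\Delta\phi_\alpha$. Assume square integrability, $\mathbb E\phi_{P_{\alpha_1}}^{N_{\alpha_2}}\to\phi_\infty$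 and (MIMC1). For the Milstein scheme (iterated integrals of $dW_q^j\,dW_p^k$ replaced by $\frac12(\Delta W_q^j\Delta W_p^k-h\,\delta_{qp}\delta_{jk})$, i.e. without Lévy areas), if (MIMC2) holds with $s_P=1$, $s_N=2$, the conclusion of (b) holds with index sets $\{2\alpha_1+\alpha_2\le L\}$ and work $O(\mathrm{tol}^{-2}\log(\mathrm{tol}^{-1})^2)$. For the Euler–Maruyama scheme, if (MIMC2) holds with $s_P=s_N=1$, it holds with index sets $\{2\alpha_1+2\alpha_2\le L\}$ and work $O(\mathrm{tol}^{-2}\log(\mathrm{tol}^{-1})^4)$. -/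

import Mathlib

open MeasureTheory ProbabilityTheory Filter Topology
open scoped NNReal ENNReal Matrix

namespace MIMC

noncomputable section

/-- The state space `ℝ^d` of a single particle. -/
abbrev Vec (d : ℕ) := EuclideanSpace ℝ (Fin d)

/-! ### The particle system and its mean-field limit -/

/-- The data of the particle system
`dX_p = a(t, X_p, μ_X) dt + σ(t, X_p, μ_X) dW_p`, `X_p(0) = x_p^0`, where `μ_X` is the empirical
measure, and of the quantity of interest `E[ψ(X_∞(T))]`.
`Ω₀` is the sample space of the random inputs of ONE particle: its initial value, its Wiener path
and the random parameter (with values in `Θ`) on which `a` and `σ` may depend.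
The coefficients are only ever evaluated at probability measures. -/
structure ParticleSystem (d : ℕ) (Θ Ω₀ : Type*) where
  drift : ℝ≥0 → Θ → Vec d → Measure (Vec d) → Vec d
  vol : ℝ≥0 → Θ → Vec d → Measure (Vec d) → Matrix (Fin d) (Fin d) ℝ
  init : Ω₀ → Vec d
  param : Ω₀ → Θ
  wiener : ℝ≥0 → Ω₀ → Vec d
  horizon : ℝ≥0
  qoi : Vec d → ℝ

namespace ParticleSystem

variable {d : ℕ} {Θ Ω₀ : Type*}

/-- The standing conventions on the random inputs of a particle: `W` is a `d`-dimensional Wiener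
process that is independent of the initial value and of the random parameter, and `T > 0`. -/
structure IsAdmissible [MeasurableSpace Θ] [MeasurableSpace Ω₀]
    (S : ParticleSystem d Θ Ω₀) (μ : Measure Ω₀) : Prop where
  measurable_init : Measurable S.init
  measurable_param : Measurable S.param
  measurable_wiener : ∀ t, Measurable (S.wiener t)
  measurable_qoi : Measurable S.qoi
  brownian : ∀ i : Fin d, IsBrownianReal (fun t ω => S.wiener t ω i) μ
  indep_coord : iIndepFun (fun (i : Fin d) (ω : Ω₀) (t : ℝ≥0) => S.wiener t ω i) μ
  indep_init : IndepFun (fun ω => (S.init ω, S.param ω)) (fun (ω : Ω₀) (t : ℝ≥0) => S.wiener t ω) μ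
  horizon_pos : 0 < S.horizon

/-- The `k`-th column of the diffusion matrix. -/
def volCol (S : ParticleSystem d Θ Ω₀) (t : ℝ≥0) (ξ : Θ) (x : Vec d) (ν : Measure (Vec d))
    (k : Fin d) : Vec d :=
  WithLp.toLp 2 (fun i => S.vol t ξ x ν i k)

/-- The generator `a · ∇f + ½ tr(σ σᵀ ∇²f)`. -/
def generator (S : ParticleSystem d Θ Ω₀) (f : Vec d → ℝ) (t : ℝ≥0) (ξ : Θ) (x : Vec d)
    (ν : Measure (Vec d)) : ℝ :=
  fderiv ℝ f x (S.drift t ξ x ν)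
    + (1 / 2) * ∑ k : Fin d, iteratedFDeriv ℝ 2 f x (fun _ => S.volCol t ξ x ν k)

/-- `X` (with random parameter `ξ`) is a weak solution of the McKean-Vlasov equation
`dX_∞ = a(t, X_∞, μ^t) dt + σ(t, X_∞, μ^t) dW`, `μ^t = law of X_∞(t)`, with the same initial data as
a particle of `S`: it solves the corresponding (local) martingale problem. -/
structure IsMeanFieldLimit [MeasurableSpace Θ] [MeasurableSpace Ω₀]
    (S : ParticleSystem d Θ Ω₀) (μ : Measure Ω₀) {Ω' : Type*} [mΩ' : MeasurableSpace Ω']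
    (P' : Measure Ω') (X : ℝ≥0 → Ω' → Vec d) (ξ : Ω' → Θ) : Prop where
  initial : IdentDistrib (fun ω => (X 0 ω, ξ ω)) (fun ω => (S.init ω, S.param ω)) P' μ
  continuous_paths : ∀ᵐ ω ∂P', Continuous (fun t => X t ω)
  integrable_drift : ∀ t : ℝ≥0, ∀ᵐ ω ∂P',
    MemLp (fun s : ℝ => S.drift s.toNNReal (ξ ω) (X s.toNNReal ω) (P'.map (X s.toNNReal))) 1
      (volume.restrict (Set.Ioc 0 (t : ℝ)))
  integrable_vol : ∀ t : ℝ≥0, ∀ i k : Fin d, ∀ᵐ ω ∂P',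
    MemLp (fun s : ℝ => S.vol s.toNNReal (ξ ω) (X s.toNNReal ω) (P'.map (X s.toNNReal)) i k) 2
      (volume.restrict (Set.Ioc 0 (t : ℝ)))
  martingale_problem : ∃ ℱ : Filtration ℝ≥0 mΩ', Measurable[ℱ 0] ξ ∧ StronglyAdapted ℱ X ∧
    ∀ f : Vec d → ℝ, ContDiff ℝ ((⊤ : ℕ∞) : WithTop ℕ∞) f → HasCompactSupport f →
      Locally (fun M => Martingale M ℱ P') ℱ
        (fun (t : ℝ≥0) ω => f (X t ω) - f (X 0 ω)
          - ∫ s in (0 : ℝ)..t, S.generator f s.toNNReal (ξ ω) (X s.toNNReal ω)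
              (P'.map (X s.toNNReal))) P'

end ParticleSystem

/-! ### Time stepping -/

/-- The empirical measure of `P` points. -/
def empirical {d P : ℕ} (x : Fin P → Vec d) : Measure (Vec d) :=
  (P : ℝ≥0∞)⁻¹ • ∑ q, Measure.dirac (x q)

/-- A one-step time-stepping scheme for the system of `P` particles: from the time `t`, the step
size `h`, the random inputs of the `P` particles and the present positions it computes the positions
at time `t + h`. -/
abbrev Scheme (d : ℕ) (Ω₀ : Type*) :=
  (P : ℕ) → (t h : ℝ≥0) → (Fin P → Ω₀) → (Fin P → Vec d) → (Fin P → Vec d)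

namespace ParticleSystem

variable {d : ℕ} {Θ Ω₀ : Type*}

/-- The Euler-Maruyama scheme. -/
def eulerMaruyama (S : ParticleSystem d Θ Ω₀) : Scheme d Ω₀ := fun _ t h ω x p =>
  x p + (h : ℝ) • S.drift t (S.param (ω p)) (x p) (empirical x)
    + WithLp.toLp 2 (S.vol t (S.param (ω p)) (x p) (empirical x) *ᵥ
        fun k => S.wiener (t + h) (ω p) k - S.wiener t (ω p) k)

/-- The Milstein scheme, for the SDE in `ℝ^{P d}` that the system of `P` particles is.
The iterated Itô integral of `dW_q^j dW_p^k` is represented by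
`½ (ΔW_q^j ΔW_p^k - h δ_{(q,j),(p,k)})`, as is usual; this is the exact Milstein scheme whenever
no Lévy areas occur in it (e.g. `d = 1` and `σ` independent of the empirical measure), and it is the
Euler-Maruyama scheme if `σ` is constant. -/
def milstein (S : ParticleSystem d Θ Ω₀) : Scheme d Ω₀ := fun P t h ω x p =>
  S.eulerMaruyama P t h ω x p
    + WithLp.toLp 2 (fun i => (1 / 2 : ℝ) * ∑ q : Fin P, ∑ j : Fin d, ∑ k : Fin d,
        lineDeriv ℝ (fun y : Fin P → Vec d => S.vol t (S.param (ω p)) (y p) (empirical y) i k) x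
            (Pi.single q (S.volCol t (S.param (ω q)) (x q) (empirical x) j))
          * ((S.wiener (t + h) (ω q) j - S.wiener t (ω q) j)
              * (S.wiener (t + h) (ω p) k - S.wiener t (ω p) k)
            - if q = p ∧ j = k then (h : ℝ) else 0))

/-- The positions of the `P` particles after `n` of `N` uniform time steps on `[0, T]`. -/
def position (S : ParticleSystem d Θ Ω₀) (sch : Scheme d Ω₀) (P N : ℕ) (ω : Fin P → Ω₀) :
    ℕ → Fin P → Vec d
  | 0 => fun p => S.init (ω p)
  | n + 1 => sch P (n * S.horizon / N) (S.horizon / N) ω (S.position sch P N ω n)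

/-- `φ_P^N = (1/P) ∑_p ψ(X_p^{N|N})`, as a function of the random inputs of the `P` particles. -/
def phi (S : ParticleSystem d Θ Ω₀) (sch : Scheme d Ω₀) (P N : ℕ) (ω : Fin P → Ω₀) : ℝ :=
  (1 / (P : ℝ)) * ∑ p, S.qoi (S.position sch P N ω N p)

end ParticleSystem

/-! ### Samplers and mixed differences -/

/-- A correlated sampler: `vphi ℓ N` is a function of the random inputs of `P_{ℓ+1} = β^{ℓ+1}`
particles, used as the coarse counterpart (with `P_ℓ = β^ℓ` particles) of `φ_{P_{ℓ+1}}^N`. -/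
abbrev Sampler (β : ℕ) (Ω₀ : Type*) := (ℓ N : ℕ) → (Fin (β ^ (ℓ + 1)) → Ω₀) → ℝ

namespace ParticleSystem

variable {d : ℕ} {Θ Ω₀ : Type*}

/-- The partitioning sampler: the `β^{ℓ+1}` particles are split into `β` consecutive groups of
`β^ℓ` particles, each group is simulated as a separate system, and the results are averaged. -/
def partitioning (S : ParticleSystem d Θ Ω₀) (sch : Scheme d Ω₀) (β : ℕ) : Sampler β Ω₀ :=
  fun ℓ N ω => (1 / (β : ℝ)) * ∑ i : Fin β,
    S.phi sch (β ^ ℓ) N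
      (fun q => ω (Fin.cast (by rw [pow_succ, mul_comm]) (finProdFinEquiv (i, q))))

/-- `φ_{P_k}^N - ϕ_{P_{k-1}}^N`, with the convention `ϕ_{P_{-1}} = 0`. -/
def levelDiff (S : ParticleSystem d Θ Ω₀) (sch : Scheme d Ω₀) (β : ℕ) (vphi : Sampler β Ω₀)
    (N : ℕ) : (k : ℕ) → (Fin (β ^ k) → Ω₀) → ℝ
  | 0, ω => S.phi sch (β ^ 0) N ω
  | k + 1, ω => S.phi sch (β ^ (k + 1)) N ω - vphi k N ω

/-- The first-order mixed difference `Δφ_{P_{α₁}}^{N_{α₂}}`, where `P_{α₁} = β^{α₁}`,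
`N_{α₂} = β^{α₂}` and quantities with a negative index vanish. -/
def mixedDiff (S : ParticleSystem d Θ Ω₀) (sch : Scheme d Ω₀) (β : ℕ) (vphi : Sampler β Ω₀)
    (α : ℕ × ℕ) (ω : Fin (β ^ α.1) → Ω₀) : ℝ :=
  match α.2 with
  | 0 => S.levelDiff sch β vphi (β ^ 0) α.1 ω
  | k + 1 => S.levelDiff sch β vphi (β ^ (k + 1)) α.1 ω - S.levelDiff sch β vphi (β ^ k) α.1 ω

variable [MeasurableSpace Ω₀]

/-- The approximations `φ_{P_{α₁}}^{N_{α₂}}` have finite second moments. -/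
def SquareIntegrable (S : ParticleSystem d Θ Ω₀) (μ : Measure Ω₀) [SigmaFinite μ]
    (sch : Scheme d Ω₀) (β : ℕ) : Prop :=
  ∀ α : ℕ × ℕ, MemLp (S.phi sch (β ^ α.1) (β ^ α.2)) 2 (Measure.pi fun _ => μ)

/-- `E[φ_P^N] → l` as the numbers of particles and of time steps tend to infinity. -/
def Consistent (S : ParticleSystem d Θ Ω₀) (μ : Measure Ω₀) [SigmaFinite μ]
    (sch : Scheme d Ω₀) (β : ℕ) (l : ℝ) : Prop :=
  Tendsto (fun α : ℕ × ℕ => ∫ ω, S.phi sch (β ^ α.1) (β ^ α.2) ω ∂(Measure.pi fun _ => μ))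
    atTop (𝓝 l)

/-- The requirement on a sampler: `E[ϕ_{P_ℓ}^N] = E[φ_{P_ℓ}^N]` (and finite second moments). -/
def IsSampler (S : ParticleSystem d Θ Ω₀) (μ : Measure Ω₀) [SigmaFinite μ]
    (sch : Scheme d Ω₀) (β : ℕ) (vphi : Sampler β Ω₀) : Prop :=
  ∀ ℓ k : ℕ, MemLp (vphi ℓ (β ^ k)) 2 (Measure.pi fun _ => μ) ∧
    ∫ ω, vphi ℓ (β ^ k) ω ∂(Measure.pi fun _ => μ)
      = ∫ ω, S.phi sch (β ^ ℓ) (β ^ k) ω ∂(Measure.pi fun _ => μ)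

end ParticleSystem

/-- `P_{α₁}^a N_{α₂}^b`. -/
def rate (β : ℕ) (a b : ℝ) (α : ℕ × ℕ) : ℝ := ((β : ℝ) ^ α.1) ^ a * ((β : ℝ) ^ α.2) ^ b

namespace ParticleSystem

variable {d : ℕ} {Θ Ω₀ : Type*} [MeasurableSpace Ω₀]

/-- `|E[Δφ_{P_{α₁}}^{N_{α₂}}]| ≲ P_{α₁}^{-1} N_{α₂}^{-1}`. -/
def MIMC1 (S : ParticleSystem d Θ Ω₀) (μ : Measure Ω₀) [SigmaFinite μ] (sch : Scheme d Ω₀)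
    (β : ℕ) (vphi : Sampler β Ω₀) : Prop :=
  ∃ c : ℝ, ∀ α : ℕ × ℕ,
    |∫ ω, S.mixedDiff sch β vphi α ω ∂(Measure.pi fun _ => μ)| ≤ c * rate β (-1) (-1) α

/-- `Var[Δφ_{P_{α₁}}^{N_{α₂}}] ≲ P_{α₁}^{-s_P-1} N_{α₂}^{-s_N}`. -/
def MIMC2 (S : ParticleSystem d Θ Ω₀) (μ : Measure Ω₀) [SigmaFinite μ] (sch : Scheme d Ω₀)
    (β : ℕ) (vphi : Sampler β Ω₀) (sP sN : ℝ) : Prop :=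
  ∃ c : ℝ, ∀ α : ℕ × ℕ,
    variance (S.mixedDiff sch β vphi α) (Measure.pi fun _ => μ) ≤ c * rate β (-sP - 1) (-sN) α

end ParticleSystem

/-! ### Work -/

/-- The work of one sample of `φ_{P_k}^N - ϕ_{P_{k-1}}^N` with the partitioning sampler, if
one sample of `φ_P^N` has work `cost P N`: a system of `β^k` particles, and `β` systems of
`β^{k-1}` particles, are simulated. -/
def levelWork (β : ℕ) (cost : ℕ → ℕ → ℝ) (N : ℕ) : ℕ → ℝ
  | 0 => cost (β ^ 0) N
  | k + 1 => cost (β ^ (k + 1)) N + β * cost (β ^ k) N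

/-- The work of one sample of the mixed difference with the partitioning sampler. -/
def partitioningWork (β : ℕ) (cost : ℕ → ℕ → ℝ) (α : ℕ × ℕ) : ℝ :=
  match α.2 with
  | 0 => levelWork β cost (β ^ 0) α.1
  | k + 1 => levelWork β cost (β ^ (k + 1)) α.1 + levelWork β cost (β ^ k) α.1

/-- The naive work: one sample of `φ_P^N` costs `O(N P²)`, since in each of the `N` time steps the
empirical measure of `P` particles is evaluated for each of the `P` particles. -/
def IsNaiveCost (cost : ℕ → ℕ → ℝ) : Prop :=
  ∃ κ : ℝ, ∀ P N : ℕ, 1 ≤ P → 1 ≤ N → 0 ≤ cost P N ∧ cost P N ≤ κ * (N * (P : ℝ) ^ 2)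

/-! ### The index set, the exponents and the estimator -/

/-- `I(L) = {α ∈ ℕ² : (1 - s_P + γ_P) α₁ + (3 - s_N) α₂ ≤ L}`. -/
def indexSet (γP sP sN L : ℝ) : Set (ℕ × ℕ) :=
  {α | (1 - sP + γP) * α.1 + (3 - sN) * α.2 ≤ L}

/-- `ζ = max((γ_P - s_P - 1)/2, (1 - s_N)/2)`. -/
def zetaExp (γP sP sN : ℝ) : ℝ := max ((γP - sP - 1) / 2) ((1 - sN) / 2)

/-- `ξ = min((2 - s_P)/γ_P, 2 - s_N)`. -/
def xiExp (γP sP sN : ℝ) : ℝ := min ((2 - sP) / γP) (2 - sN)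

open Classical in
/-- `𝔷`: the multiplicity of the maximum in `ζ`. -/
def zExp (γP sP sN : ℝ) : ℝ := if γP - sP - 1 = 1 - sN then 2 else 1

open Classical in
/-- The exponent `𝔭` of the logarithm. -/
def pExp (γP sP sN : ℝ) : ℝ :=
  if zetaExp γP sP sN < 0 then 0
  else if zetaExp γP sP sN = 0 then 2 * zExp γP sP sN
  else if 0 < xiExp γP sP sN then 2 * (zExp γP sP sN - 1) * (zetaExp γP sP sN + 1)
  else 1 + 2 * (zExp γP sP sN - 1) * (zetaExp γP sP sN + 1)

/-- The MIMC estimator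
`∑_{α ∈ I} (1/M_α) ∑_{m=1}^{M_α} Δφ_α(ω^{(α,m)}_{1:P_{α₁}})`;
`Δ α` is the mixed difference as a function of the random inputs, and `smp (α, m, q)` is the
random input of the `q`-th particle in the `m`-th sample at the index `α`. -/
def estimator {Ω Ω₀ : Type*} {β : ℕ} (Δ : (α : ℕ × ℕ) → (Fin (β ^ α.1) → Ω₀) → ℝ)
    (smp : (ℕ × ℕ) × ℕ × ℕ → Ω → Ω₀) (I : Finset (ℕ × ℕ)) (M : ℕ × ℕ → ℕ) (w : Ω) : ℝ :=
  ∑ α ∈ I, (1 / (M α : ℝ)) * ∑ m ∈ Finset.range (M α), Δ α (fun q => smp (α, m, (q : ℕ)) w)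

/-- MIMC with index sets `I(L)` estimates `l` to tolerance `tol` with total work
`∑_{α ∈ I(L)} M_α work(α) = O(tol^{-a} log(tol^{-1})^q)`.
The tolerance splitting `θ` may depend on `tol`, as long as it stays away from `0` and `1`, and the
constant `C` in the variance constraint is arbitrary (in particular it may be the normal
quantile with `Φ(C) = 1 - ε/2`). -/
def HasComplexity {Ω Ω₀ : Type*} [MeasurableSpace Ω] (Pr : Measure Ω) {β : ℕ}
    (smp : (ℕ × ℕ) × ℕ × ℕ → Ω → Ω₀) (Δ : (α : ℕ × ℕ) → (Fin (β ^ α.1) → Ω₀) → ℝ)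
    (work : ℕ × ℕ → ℝ) (l : ℝ) (𝓘 : ℝ → Set (ℕ × ℕ)) (a q : ℝ) : Prop :=
  ∀ ε : ℝ, 0 < ε → ε < 1 → ∀ C : ℝ, 0 < C → ∀ θ₀ : ℝ, 0 < θ₀ →
  ∃ K : ℝ, ∀ tol : ℝ, 0 < tol → tol < Real.exp (-1) → ∀ θ : ℝ, θ₀ ≤ θ → θ ≤ 1 - θ₀ →
  ∃ L : ℝ, 0 < L ∧ ∃ I : Finset (ℕ × ℕ), (I : Set (ℕ × ℕ)) = 𝓘 L ∧
  ∃ M : ℕ × ℕ → ℕ, (∀ α ∈ I, 0 < M α) ∧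
    MemLp (estimator Δ smp I M) 2 Pr ∧
    |∫ w, estimator Δ smp I M w ∂Pr - l| ≤ (1 - θ) * tol ∧
    variance (estimator Δ smp I M) Pr ≤ (θ * tol / C) ^ 2 ∧
    Pr.real {w | θ * tol ≤ |estimator Δ smp I M w - ∫ w', estimator Δ smp I M w' ∂Pr|} ≤ ε ∧
    Pr.real {w | tol ≤ |estimator Δ smp I M w - l|} ≤ ε ∧
    ∑ α ∈ I, (M α : ℝ) * work α ≤ K * tol ^ (-a) * (Real.log tol⁻¹) ^ q

/-- `I(L)` is finite and is the unique optimal finite index set at its accuracy, when errors,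
variances and work per sample are measured by `err`, `var`, `work`: for every other finite
index set `J` whose truncation error `∑_{α ∉ J} err α` is no larger, and for all sample numbers
(real, as usual in this optimization) on `J` with variance at most `v`, there are sample numbers on
`I(L)` with variance at most `v` and strictly less total work. -/
def IsOptimalIndexSet (err var work : ℕ × ℕ → ℝ) (𝓘 : Set (ℕ × ℕ)) : Prop :=
  ∃ I : Finset (ℕ × ℕ), (I : Set (ℕ × ℕ)) = 𝓘 ∧
    ∀ J : Finset (ℕ × ℕ), J ≠ I →
      ∑' α : {α // α ∉ J}, err α ≤ ∑' α : {α // α ∉ I}, err α →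
      ∀ v : ℝ, 0 < v → ∀ M : ℕ × ℕ → ℝ, (∀ α ∈ J, 0 < M α) → ∑ α ∈ J, var α / M α ≤ v →
        ∃ M' : ℕ × ℕ → ℝ, (∀ α ∈ I, 0 < M' α) ∧ ∑ α ∈ I, var α / M' α ≤ v ∧
          ∑ α ∈ I, M' α * work α < ∑ α ∈ J, M α * work α

end

end MIMC

/-! Put `A = 1 - sP + γP`, `B = 3 - sN`, `η = max A B = 2ζ + 2`, `κ = 𝔷 - 1` and `ℓ = log tol⁻¹`. By
Cauchy-Schwarz, an index set `I` with variance budget `v` costs at least `(∑_I s)² / v`, where `s =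
√(var · work)`, and `M ∝ √(var / work)` attains this. Choosing `I` is thus a knapsack problem with
value `err` and weight `s`. Up to a constant, `err / s` is `β ^ (-(A α₁ + B α₂) / 2)`, so the sets
`A α₁ + B α₂ ≤ L` are the superlevel sets of this ratio, and an exchange argument makes them optimal
(`isOptimalIndexSet_of_threshold`).

For the complexity, the means of the mixed differences telescope over boxes, so the bias is at most
the sum of `|E Δφ|` above the line, of order `(1 + L)^κ β ^ (-L / η)`. Bringing this below `tol`
leads to `β ^ L ≈ tol ^ (-η) ℓ ^ (κ η)` (`exists_level_of_truncation`). Rounding the optimal sample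
numbers up bounds the work by a multiple of `(∑ s)² / v + ∑ w`, with `w` the work rate and `v ≈
tol²`. Since `s` has exponents `(A - 2)/2` and `(B - 2)/2`, its sum is bounded for `η < 2`,
polynomial in `L` for `η = 2`, and of order `(1 + L)^κ β ^ ((η - 2) L / (2η))` for `η > 2`. The
rounding term is at most of order `(1 + L) β ^ L`, and its factor `1 + L` disappears if `B > 1`,
which is the condition `ξ > 0`. `exists_level_work` combines these bounds; the remaining probability
consists of independence of the samples and Chebyshev's inequality. -/

namespace MIMC

open Finset

/-! ### Truncated geometric sums in one variable. -/

section Sums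

theorem sum_filter_pow_le_of_one_lt {r : ℝ} (hr : 1 < r) (n : ℕ) (t : ℝ) :
    ∑ i ∈ (range n).filter (fun i : ℕ => (i : ℝ) ≤ t), r ^ i ≤ r / (r - 1) * r ^ t := by
  have hr0 : 0 < r := by linarith
  have hr1 : 0 < r - 1 := by linarith
  rcases lt_or_ge t 0 with ht | ht
  · rw [Finset.filter_false_of_mem]
    · simp only [sum_empty]; positivity
    · intro i _ h
      have : (0 : ℝ) ≤ i := i.cast_nonneg
      linarith
  calc ∑ i ∈ (range n).filter (fun i : ℕ => (i : ℝ) ≤ t), r ^ i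
      ≤ ∑ i ∈ range (⌊t⌋₊ + 1), r ^ i := by
        apply sum_le_sum_of_subset_of_nonneg
        · intro i hi
          simp only [mem_filter, Finset.mem_range] at hi ⊢
          exact Nat.lt_succ_of_le (Nat.le_floor hi.2)
        · intros; positivity
    _ = (r ^ (⌊t⌋₊ + 1) - 1) / (r - 1) := geom_sum_eq hr.ne' _
    _ ≤ r ^ (⌊t⌋₊ + 1) / (r - 1) := by gcongr; linarith
    _ = r / (r - 1) * r ^ ((⌊t⌋₊ : ℕ) : ℝ) := by rw [Real.rpow_natCast, pow_succ]; ring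
    _ ≤ r / (r - 1) * r ^ t := by
        gcongr
        · exact hr.le
        · exact Nat.floor_le ht

theorem sum_filter_one_le (n : ℕ) {t : ℝ} (ht : 0 ≤ t) :
    ∑ _i ∈ (range n).filter (fun i : ℕ => (i : ℝ) ≤ t), (1 : ℝ) ≤ 1 + t := by
  have h : (range n).filter (fun i : ℕ => (i : ℝ) ≤ t) ⊆ range (⌊t⌋₊ + 1) := by
    intro i hi
    simp only [mem_filter, Finset.mem_range] at hi ⊢
    exact Nat.lt_succ_of_le (Nat.le_floor hi.2)
  have h2 := card_le_card h
  rw [card_range] at h2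
  simp only [sum_const, nsmul_eq_mul, mul_one]
  have h3 : (#((range n).filter (fun i : ℕ => (i : ℝ) ≤ t)) : ℝ) ≤ ((⌊t⌋₊ + 1 : ℕ) : ℝ) := by
    exact_mod_cast h2
  push_cast at h3
  linarith [Nat.floor_le ht]

theorem sum_pow_le_of_lt_one {r : ℝ} (hr0 : 0 ≤ r) (hr : r < 1) (s : Finset ℕ) :
    ∑ i ∈ s, r ^ i ≤ (1 - r)⁻¹ := by
  rw [← tsum_geometric_of_lt_one hr0 hr]
  exact (summable_geometric_of_lt_one hr0 hr).sum_le_tsum s (fun i _ => pow_nonneg hr0 i)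

/-- A tail of the geometric series starts at `⌈t⌉₊`, which is at least both `t` and `0`. The
positive part is needed for columns lying entirely above the line. -/
theorem sum_filter_not_pow_le {r : ℝ} (hr0 : 0 < r) (hr : r < 1) (n : ℕ) (t : ℝ) :
    ∑ i ∈ (range n).filter (fun i : ℕ => ¬ (i : ℝ) ≤ t), r ^ i ≤ (1 - r)⁻¹ * r ^ (max t 0) := by
  have hr1 : 0 < (1 - r)⁻¹ := inv_pos.2 (by linarith)
  have key : ∀ i ∈ (range n).filter (fun i : ℕ => ¬ (i : ℝ) ≤ t), ⌈t⌉₊ ≤ i := by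
    intro i hi
    simp only [mem_filter, not_le] at hi
    exact Nat.ceil_le.2 hi.2.le
  calc ∑ i ∈ (range n).filter (fun i : ℕ => ¬ (i : ℝ) ≤ t), r ^ i
      = ∑ i ∈ (range n).filter (fun i : ℕ => ¬ (i : ℝ) ≤ t), r ^ ⌈t⌉₊ * r ^ (i - ⌈t⌉₊) := by
        apply sum_congr rfl
        intro i hi
        rw [← pow_add, Nat.add_sub_cancel' (key i hi)]
    _ = r ^ ⌈t⌉₊ * ∑ i ∈ ((range n).filter (fun i : ℕ => ¬ (i : ℝ) ≤ t)).image (· - ⌈t⌉₊),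
          r ^ i := by
        rw [← mul_sum, sum_image]
        intro i hi j hj hij
        have h1 := key i hi
        have h2 := key j hj
        simp only at hij
        omega
    _ ≤ r ^ ((⌈t⌉₊ : ℕ) : ℝ) * (1 - r)⁻¹ := by
        rw [Real.rpow_natCast]
        gcongr
        exact sum_pow_le_of_lt_one hr0.le hr _
    _ ≤ r ^ (max t 0) * (1 - r)⁻¹ := by
        gcongr ?_ * _
        exact Real.rpow_le_rpow_of_exponent_ge hr0 hr.le
          (max_le (Nat.le_ceil t) (Nat.cast_nonneg _))
    _ = _ := mul_comm _ _

/-! ### Mixed rates and their sums below and above a line. -/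

theorem pow_rpow_eq_rpow_pow {b : ℝ} (hb : 0 ≤ b) (x : ℝ) (i : ℕ) : (b ^ i) ^ x = (b ^ x) ^ i := by
  rw [← Real.rpow_natCast, ← Real.rpow_natCast, ← Real.rpow_mul hb, ← Real.rpow_mul hb, mul_comm]

theorem pow_rpow_eq_rpow_mul {b : ℝ} (hb : 0 ≤ b) (x : ℝ) (i : ℕ) : (b ^ i) ^ x = b ^ (x * i) := by
  rw [← Real.rpow_natCast, ← Real.rpow_mul hb, mul_comm]

variable {β : ℕ}

theorem rate_pos (hβ : 2 ≤ β) (x y : ℝ) (α : ℕ × ℕ) : 0 < rate β x y α := by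
  have : (0 : ℝ) < β := by exact_mod_cast (by omega : 0 < β)
  unfold rate; positivity

theorem rate_mul (hβ : 2 ≤ β) (x y x' y' : ℝ) (α : ℕ × ℕ) :
    rate β x y α * rate β x' y' α = rate β (x + x') (y + y') α := by
  have : (0 : ℝ) < β := by exact_mod_cast (by omega : 0 < β)
  unfold rate
  rw [Real.rpow_add (by positivity), Real.rpow_add (by positivity)]
  ring

theorem rate_eq_rpow (hβ : 2 ≤ β) (x y : ℝ) (α : ℕ × ℕ) :
    rate β x y α = (β : ℝ) ^ (x * α.1 + y * α.2) := by
  have : (0 : ℝ) < β := by exact_mod_cast (by omega : 0 < β)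
  unfold rate
  rw [pow_rpow_eq_rpow_mul this.le, pow_rpow_eq_rpow_mul this.le, Real.rpow_add this]

theorem rate_le_rate (hβ : 2 ≤ β) {x y x' y' : ℝ} (hx : x ≤ x') (hy : y ≤ y') (α : ℕ × ℕ) :
    rate β x y α ≤ rate β x' y' α := by
  rw [rate_eq_rpow hβ, rate_eq_rpow hβ]
  have : (1 : ℝ) ≤ β := by exact_mod_cast (by omega : 1 ≤ β)
  gcongr

theorem rate_swap (x y : ℝ) (α : ℕ × ℕ) : rate β x y α.swap = rate β y x α := by
  simp only [rate, Prod.fst_swap, Prod.snd_swap]; ring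

/-- The indices with `A α₁ + B α₂ ≤ L` in an `n × n` box. -/
noncomputable def boxLe (A B L : ℝ) (n : ℕ) : Finset (ℕ × ℕ) :=
  (range n ×ˢ range n).filter (fun α => A * α.1 + B * α.2 ≤ L)

/-- The indices with `A α₁ + B α₂ > L` in an `n × n` box. -/
noncomputable def boxGt (A B L : ℝ) (n : ℕ) : Finset (ℕ × ℕ) :=
  (range n ×ˢ range n).filter (fun α => ¬ A * α.1 + B * α.2 ≤ L)

theorem sum_boxLe_swap (f : ℕ × ℕ → ℝ) (A B L : ℝ) (n : ℕ) :
    ∑ α ∈ boxLe A B L n, f α.swap = ∑ α ∈ boxLe B A L n, f α := by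
  refine sum_nbij' Prod.swap Prod.swap ?_ ?_ ?_ ?_ ?_ <;> simp [boxLe] <;> intros <;>
    constructor <;> first | constructor <;> assumption | linarith

theorem sum_boxGt_swap (f : ℕ × ℕ → ℝ) (A B L : ℝ) (n : ℕ) :
    ∑ α ∈ boxGt A B L n, f α.swap = ∑ α ∈ boxGt B A L n, f α := by
  refine sum_nbij' Prod.swap Prod.swap ?_ ?_ ?_ ?_ ?_ <;> simp [boxGt] <;> intros <;>
    constructor <;> first | constructor <;> assumption | linarith

/-- Summation over `boxLe` in the order `α₁`, `α₂`. -/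
theorem sum_boxLe_eq {A B : ℝ} (hB : 0 < B) (x y L : ℝ) (n : ℕ) :
    ∑ α ∈ boxLe A B L n, rate β x y α
      = ∑ i ∈ (range n).filter (fun i : ℕ => A * i ≤ L), ((β : ℝ) ^ i) ^ x *
          ∑ j ∈ (range n).filter (fun j : ℕ => (j : ℝ) ≤ (L - A * i) / B), ((β : ℝ) ^ j) ^ y := by
  rw [boxLe, sum_filter, sum_product, sum_filter]
  apply sum_congr rfl
  intro i _
  split_ifs with h
  · rw [mul_sum, sum_filter]
    apply sum_congr rfl
    intro j _
    have : A * i + B * j ≤ L ↔ (j : ℝ) ≤ (L - A * i) / B := by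
      rw [le_div_iff₀ hB]; constructor <;> intro h <;> linarith
    simp only [this, rate]
  · apply sum_eq_zero
    intro j _
    rw [if_neg]
    have : 0 ≤ B * (j : ℝ) := by positivity
    simp only; linarith

theorem sum_boxGt_eq {A B : ℝ} (hB : 0 < B) (x y L : ℝ) (n : ℕ) :
    ∑ α ∈ boxGt A B L n, rate β x y α
      = ∑ i ∈ range n, ((β : ℝ) ^ i) ^ x *
          ∑ j ∈ (range n).filter (fun j : ℕ => ¬ (j : ℝ) ≤ (L - A * i) / B), ((β : ℝ) ^ j) ^ y := by
  rw [boxGt, sum_filter, sum_product]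
  apply sum_congr rfl
  intro i _
  rw [mul_sum, sum_filter]
  apply sum_congr rfl
  intro j _
  have : A * i + B * j ≤ L ↔ (j : ℝ) ≤ (L - A * i) / B := by
    rw [le_div_iff₀ hB]; constructor <;> intro h <;> linarith
  simp only [this, rate]

theorem exists_sum_pow_rpow_le (hβ : 2 ≤ β) {x : ℝ} (hx : x < 0) :
    ∃ C : ℝ, 0 < C ∧ ∀ s : Finset ℕ, ∑ i ∈ s, ((β : ℝ) ^ i) ^ x ≤ C := by
  have hb : (1 : ℝ) < β := by exact_mod_cast (by omega : 1 < β)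
  have h1 : (β : ℝ) ^ x < 1 := Real.rpow_lt_one_of_one_lt_of_neg hb hx
  refine ⟨(1 - (β : ℝ) ^ x)⁻¹, inv_pos.2 (by linarith), fun s => ?_⟩
  simp only [pow_rpow_eq_rpow_pow (zero_le_one.trans hb.le)]
  exact sum_pow_le_of_lt_one (by positivity) h1 s

theorem sum_filter_mul_le_one_le {A L : ℝ} (hA : 1 ≤ A) (hL : 0 ≤ L) (n : ℕ) :
    ∑ _i ∈ (range n).filter (fun i : ℕ => A * i ≤ L), (1 : ℝ) ≤ 1 + L := by
  refine le_trans ?_ (sum_filter_one_le n hL)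
  apply sum_le_sum_of_subset_of_nonneg
  · intro i hi
    simp only [mem_filter] at hi ⊢
    refine ⟨hi.1, ?_⟩
    have : (i : ℝ) ≤ A * i := le_mul_of_one_le_left (Nat.cast_nonneg _) hA
    linarith
  · intros; positivity

/-- The triangle lies in a rectangle, over which the sum factorizes. This loses nothing essential
when neither exponent is positive, the case `max A B ≤ 2`. -/
theorem sum_boxLe_le_sum_mul_sum {A B : ℝ} (hA : 0 ≤ A) (hB : 0 ≤ B) (x y L : ℝ) (n : ℕ) :
    ∑ α ∈ boxLe A B L n, rate β x y α
      ≤ (∑ i ∈ (range n).filter (fun i : ℕ => A * i ≤ L), ((β : ℝ) ^ i) ^ x) *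
        ∑ j ∈ (range n).filter (fun j : ℕ => B * j ≤ L), ((β : ℝ) ^ j) ^ y := by
  rw [sum_mul_sum, ← sum_product' (f := fun i j => ((β : ℝ) ^ i) ^ x * ((β : ℝ) ^ j) ^ y)]
  apply sum_le_sum_of_subset_of_nonneg
  · intro α hα
    simp only [boxLe, mem_filter, mem_product] at hα ⊢
    have h1 : 0 ≤ A * (α.1 : ℝ) := by positivity
    have h2 : 0 ≤ B * (α.2 : ℝ) := by positivity
    exact ⟨⟨hα.1.1, by linarith⟩, hα.1.2, by linarith⟩
  · intro α _ _
    rw [rate]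
    positivity

/-- If the growth along the second axis is positive, the inner sums are geometric. -/
theorem exists_sum_boxLe_le_mul_sum (hβ : 2 ≤ β) {A B x y : ℝ} (hB : 0 < B) (hy : 0 < y) :
    ∃ C : ℝ, 0 < C ∧ ∀ (L : ℝ) (n : ℕ), ∑ α ∈ boxLe A B L n, rate β x y α
      ≤ C * (β : ℝ) ^ (y * L / B) *
        ∑ i ∈ (range n).filter (fun i : ℕ => A * i ≤ L), ((β : ℝ) ^ i) ^ (x - y * A / B) := by
  have hb : (1 : ℝ) < β := by exact_mod_cast (by omega : 1 < β)
  have hb0 : (0 : ℝ) < β := by linarith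
  have h1 : 1 < (β : ℝ) ^ y := Real.one_lt_rpow hb hy
  refine ⟨(β : ℝ) ^ y / ((β : ℝ) ^ y - 1), div_pos (by linarith) (by linarith), fun L n => ?_⟩
  rw [sum_boxLe_eq hB, mul_sum]
  apply sum_le_sum
  intro i _
  have h2 := sum_filter_pow_le_of_one_lt h1 n ((L - A * i) / B)
  simp only [← pow_rpow_eq_rpow_pow hb0.le y] at h2
  refine (mul_le_mul_of_nonneg_left h2 (by positivity)).trans_eq ?_
  rw [← Real.rpow_mul hb0.le, pow_rpow_eq_rpow_mul hb0.le, pow_rpow_eq_rpow_mul hb0.le,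
    mul_left_comm, mul_assoc, ← Real.rpow_add hb0, ← Real.rpow_add hb0]
  congr 2
  ring

/-- After the inner summation the first axis carries the exponent `x - y A / B`. If it is negative,
the corner on the second axis dominates and no power of `L` appears; if it vanishes, every column
counts equally and gives a factor `1 + L`. -/
theorem exists_sum_boxLe_le_of_lt (hβ : 2 ≤ β) {A B x y : ℝ} (hB : 0 < B) (hy : 0 < y)
    (hxy : x < y * A / B) :
    ∃ C : ℝ, 0 < C ∧ ∀ (L : ℝ) (n : ℕ), ∑ α ∈ boxLe A B L n, rate β x y α
      ≤ C * (β : ℝ) ^ (y * L / B) := by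
  obtain ⟨C, hC, h⟩ := exists_sum_boxLe_le_mul_sum (A := A) (x := x) hβ hB hy
  obtain ⟨C', hC', h'⟩ := exists_sum_pow_rpow_le hβ (sub_neg.2 hxy)
  refine ⟨C * C', by positivity, fun L n => (h L n).trans ?_⟩
  rw [mul_right_comm]
  gcongr
  exact h' _

theorem exists_sum_boxLe_le_of_eq (hβ : 2 ≤ β) {A B x y : ℝ} (hA : 1 ≤ A) (hB : 0 < B) (hy : 0 < y)
    (hxy : x = y * A / B) :
    ∃ C : ℝ, 0 < C ∧ ∀ (L : ℝ) (n : ℕ), 0 ≤ L → ∑ α ∈ boxLe A B L n, rate β x y α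
      ≤ C * (1 + L) * (β : ℝ) ^ (y * L / B) := by
  obtain ⟨C, hC, h⟩ := exists_sum_boxLe_le_mul_sum (A := A) (x := x) hβ hB hy
  refine ⟨C, by positivity, fun L n hL => (h L n).trans ?_⟩
  rw [mul_right_comm]
  gcongr
  simp only [hxy, sub_self, Real.rpow_zero]
  exact sum_filter_mul_le_one_le hA hL n

/-- The truncation error, if the second direction decays at most as fast as the first one. -/
theorem exists_sum_boxGt_le_of_lt (hβ : 2 ≤ β) {A B : ℝ} (hA : 0 < A) (hAB : A < B) :
    ∃ C : ℝ, 0 < C ∧ ∀ (L : ℝ) (n : ℕ), ∑ α ∈ boxGt A B L n, rate β (-1) (-1) α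
      ≤ C * (β : ℝ) ^ (-L / B) := by
  have hb : (1 : ℝ) < β := by exact_mod_cast (by omega : 1 < β)
  have hb0 : (0 : ℝ) < β := by linarith
  have hB : 0 < B := hA.trans hAB
  have h1 : (β : ℝ) ^ (-1 : ℝ) < 1 := Real.rpow_lt_one_of_one_lt_of_neg hb (by norm_num)
  -- Column `i` starts at height `(L - A i) / B`, so its tail is of order `β ^ (-L / B) (β ^ i) ^ (A
  -- / B)`. Together with the outer factor this leaves the exponent `-1 + A / B`.
  have hx : -1 + A / B < 0 := by
    have : A / B < 1 := (div_lt_one hB).2 hAB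
    linarith
  obtain ⟨C', hC', h'⟩ := exists_sum_pow_rpow_le hβ hx
  have hC : 0 < (1 - (β : ℝ) ^ (-1 : ℝ))⁻¹ := inv_pos.2 (by linarith)
  refine ⟨(1 - (β : ℝ) ^ (-1 : ℝ))⁻¹ * C', by positivity, fun L n => ?_⟩
  rw [sum_boxGt_eq hB]
  calc _ ≤ ∑ i ∈ range n, (1 - (β : ℝ) ^ (-1 : ℝ))⁻¹ * (β : ℝ) ^ (-L / B)
            * ((β : ℝ) ^ i) ^ (-1 + A / B) := ?_
    _ = (1 - (β : ℝ) ^ (-1 : ℝ))⁻¹ * (∑ i ∈ range n, ((β : ℝ) ^ i) ^ (-1 + A / B))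
          * (β : ℝ) ^ (-L / B) := by rw [← mul_sum]; ring
    _ ≤ _ := by gcongr; exact h' _
  apply sum_le_sum
  intro i _
  have h2 := sum_filter_not_pow_le (by positivity) h1 n ((L - A * i) / B)
  simp only [← pow_rpow_eq_rpow_pow hb0.le (-1)] at h2
  have h3 : ((β : ℝ) ^ (-1 : ℝ)) ^ max ((L - A * i) / B) 0
      ≤ ((β : ℝ) ^ (-1 : ℝ)) ^ ((L - A * i) / B) :=
    Real.rpow_le_rpow_of_exponent_ge (by positivity) h1.le (le_max_left _ _)
  calc _ ≤ ((β : ℝ) ^ i) ^ (-1 : ℝ) * ((1 - (β : ℝ) ^ (-1 : ℝ))⁻¹ *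
          ((β : ℝ) ^ (-1 : ℝ)) ^ ((L - A * i) / B)) := by
        gcongr
        exact h2.trans (by gcongr)
    _ = _ := by
        rw [← Real.rpow_mul hb0.le, pow_rpow_eq_rpow_mul hb0.le, pow_rpow_eq_rpow_mul hb0.le,
          mul_left_comm, mul_assoc, ← Real.rpow_add hb0, ← Real.rpow_add hb0]
        congr 2
        ring

/-- With equal slopes each column `i ≤ L / A` contributes the same order `β ^ (-L / A)`, whence the
factor `1 + L`. The columns beyond `L / A` are summed in full and form one more geometric tail. -/
theorem exists_sum_boxGt_le_of_eq (hβ : 2 ≤ β) {A : ℝ} (hA : 1 ≤ A) :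
    ∃ C : ℝ, 0 < C ∧ ∀ (L : ℝ) (n : ℕ), 0 ≤ L → ∑ α ∈ boxGt A A L n, rate β (-1) (-1) α
      ≤ C * (1 + L) * (β : ℝ) ^ (-L / A) := by
  have hb : (1 : ℝ) < β := by exact_mod_cast (by omega : 1 < β)
  have hb0 : (0 : ℝ) < β := by linarith
  have hA0 : 0 < A := by linarith
  have h1 : (β : ℝ) ^ (-1 : ℝ) < 1 := Real.rpow_lt_one_of_one_lt_of_neg hb (by norm_num)
  have hC : 0 < (1 - (β : ℝ) ^ (-1 : ℝ))⁻¹ := inv_pos.2 (by linarith)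
  set q := (1 - (β : ℝ) ^ (-1 : ℝ))⁻¹ with hq
  refine ⟨q * (1 + q), by positivity, fun L n hL => ?_⟩
  rw [sum_boxGt_eq hA0, ← sum_filter_add_sum_filter_not (range n) (fun i : ℕ => A * i ≤ L)]
  have hiff : ∀ i : ℕ, A * i ≤ L ↔ (i : ℝ) ≤ L / A := fun i => by
    rw [le_div_iff₀ hA0, mul_comm]
  have hin : ∀ i ∈ range n, ((β : ℝ) ^ i) ^ (-1 : ℝ) *
      ∑ j ∈ (range n).filter (fun j : ℕ => ¬ (j : ℝ) ≤ (L - A * i) / A), ((β : ℝ) ^ j) ^ (-1 : ℝ)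
      ≤ q * (((β : ℝ) ^ i) ^ (-1 : ℝ) *
        ((β : ℝ) ^ (-1 : ℝ)) ^ max ((L - A * i) / A) 0) := by
    intro i _
    have h2 := sum_filter_not_pow_le (by positivity) h1 n ((L - A * i) / A)
    simp only [← pow_rpow_eq_rpow_pow hb0.le (-1)] at h2
    rw [mul_left_comm]
    gcongr
  have e1 : ∑ i ∈ (range n).filter (fun i : ℕ => A * i ≤ L), ((β : ℝ) ^ i) ^ (-1 : ℝ) *
      ∑ j ∈ (range n).filter (fun j : ℕ => ¬ (j : ℝ) ≤ (L - A * i) / A), ((β : ℝ) ^ j) ^ (-1 : ℝ)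
      ≤ q * (β : ℝ) ^ (-L / A) * (1 + L) := by
    calc _ ≤ ∑ i ∈ (range n).filter (fun i : ℕ => A * i ≤ L), q * (β : ℝ) ^ (-L / A) * 1 := ?_
      _ ≤ _ := by
        rw [← mul_sum]
        gcongr
        exact sum_filter_mul_le_one_le hA hL n
    apply sum_le_sum
    intro i hi
    rw [mem_filter] at hi
    refine (hin i hi.1).trans_eq ?_
    rw [max_eq_left (div_nonneg (by linarith [hi.2]) hA0.le), ← Real.rpow_mul hb0.le,
      pow_rpow_eq_rpow_mul hb0.le, ← Real.rpow_add hb0, mul_one]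
    congr 2
    field_simp
    ring
  have e2 : ∑ i ∈ (range n).filter (fun i : ℕ => ¬ A * i ≤ L), ((β : ℝ) ^ i) ^ (-1 : ℝ) *
      ∑ j ∈ (range n).filter (fun j : ℕ => ¬ (j : ℝ) ≤ (L - A * i) / A), ((β : ℝ) ^ j) ^ (-1 : ℝ)
      ≤ q * (q * (β : ℝ) ^ (-L / A)) := by
    calc _ ≤ ∑ i ∈ (range n).filter (fun i : ℕ => ¬ A * i ≤ L), q * ((β : ℝ) ^ i) ^ (-1 : ℝ) := ?_
      _ ≤ _ := ?_
    · apply sum_le_sum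
      intro i hi
      rw [mem_filter] at hi
      refine (hin i hi.1).trans ?_
      have : ((β : ℝ) ^ (-1 : ℝ)) ^ max ((L - A * i) / A) 0 ≤ 1 :=
        Real.rpow_le_one (by positivity) h1.le (le_max_right _ _)
      gcongr
      exact mul_le_of_le_one_right (by positivity) this
    · rw [← mul_sum]
      simp only [hiff]
      gcongr
      have h2 := sum_filter_not_pow_le (by positivity) h1 n (L / A)
      simp only [← pow_rpow_eq_rpow_pow hb0.le (-1)] at h2
      refine h2.trans_eq ?_
      rw [max_eq_left (by positivity), ← Real.rpow_mul hb0.le]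
      congr 2
      ring
  refine (add_le_add e1 e2).trans ?_
  have hp : 0 < (β : ℝ) ^ (-L / A) := by positivity
  nlinarith [mul_pos hC hp, mul_pos (mul_pos hC hC) hp,
    mul_nonneg (mul_pos (mul_pos hC hC) hp).le hL]

/-- The direction with the larger coefficient reaches the line soonest and governs the tail.
Exchanging the axes reduces to `A < B`; `κ` counts the logarithm caused by a tie. -/
theorem exists_sum_boxGt_le (hβ : 2 ≤ β) {A B κ : ℝ} (hA : 1 ≤ A) (hB : 1 ≤ B)
    (hκ : A = B ∧ κ = 1 ∨ A ≠ B ∧ κ = 0) :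
    ∃ C : ℝ, 0 < C ∧ ∀ (L : ℝ) (n : ℕ), 0 ≤ L → ∑ α ∈ boxGt A B L n, rate β (-1) (-1) α
      ≤ C * (1 + L) ^ κ * (β : ℝ) ^ (-L / max A B) := by
  rcases hκ with ⟨rfl, rfl⟩ | ⟨hne, rfl⟩
  · simpa using exists_sum_boxGt_le_of_eq hβ hA
  rcases lt_or_gt_of_ne hne with h | h
  · obtain ⟨C, hC, hC'⟩ := exists_sum_boxGt_le_of_lt hβ (by linarith) h
    refine ⟨C, hC, fun L n _ => ?_⟩
    rw [max_eq_right h.le, Real.rpow_zero, mul_one]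
    exact hC' L n
  · obtain ⟨C, hC, hC'⟩ := exists_sum_boxGt_le_of_lt hβ (by linarith) h
    refine ⟨C, hC, fun L n _ => ?_⟩
    rw [max_eq_left h.le, Real.rpow_zero, mul_one, ← sum_boxGt_swap]
    simp only [rate_swap]
    exact hC' L n

/-! ### Sums of the square root of variance times work, and of the work per sample. -/

theorem exists_sum_boxLe_le_of_max_lt_two (hβ : 2 ≤ β) {A B : ℝ} (hA : 1 ≤ A) (hB : 1 ≤ B)
    (h : max A B < 2) :
    ∃ C : ℝ, 0 < C ∧ ∀ (L : ℝ) (n : ℕ),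
      ∑ α ∈ boxLe A B L n, rate β ((A - 2) / 2) ((B - 2) / 2) α ≤ C := by
  have hA2 := (le_max_left A B).trans_lt h
  have hB2 := (le_max_right A B).trans_lt h
  obtain ⟨C, hC, h1⟩ := exists_sum_pow_rpow_le hβ (show (A - 2) / 2 < 0 by linarith)
  obtain ⟨C', hC', h2⟩ := exists_sum_pow_rpow_le hβ (show (B - 2) / 2 < 0 by linarith)
  refine ⟨C * C', by positivity, fun L n => ?_⟩
  refine (sum_boxLe_le_sum_mul_sum (by linarith) (by linarith) _ _ _ _).trans ?_
  gcongr
  · exact h1 _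
  · exact h2 _

theorem exists_sum_boxLe_le_of_eq_two (hβ : 2 ≤ β) {A B : ℝ} (hA : 1 ≤ A) (hB : B = 2) (h : A < B) :
    ∃ C : ℝ, 0 < C ∧ ∀ (L : ℝ) (n : ℕ), 0 ≤ L →
      ∑ α ∈ boxLe A B L n, rate β ((A - 2) / 2) ((B - 2) / 2) α ≤ C * (1 + L) := by
  obtain ⟨C, hC, h1⟩ := exists_sum_pow_rpow_le hβ (show (A - 2) / 2 < 0 by linarith)
  refine ⟨C, by positivity, fun L n hL => ?_⟩
  refine (sum_boxLe_le_sum_mul_sum (by linarith) (by linarith) _ _ _ _).trans ?_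
  gcongr
  · exact h1 _
  · subst hB
    simpa using sum_filter_mul_le_one_le (A := 2) (by norm_num) hL n

theorem exists_sum_boxLe_le_of_max_eq_two (hβ : 2 ≤ β) {A B κ : ℝ} (hA : 1 ≤ A) (hB : 1 ≤ B)
    (hκ : A = B ∧ κ = 1 ∨ A ≠ B ∧ κ = 0) (h : max A B = 2) :
    ∃ C : ℝ, 0 < C ∧ ∀ (L : ℝ) (n : ℕ), 0 ≤ L →
      ∑ α ∈ boxLe A B L n, rate β ((A - 2) / 2) ((B - 2) / 2) α ≤ C * (1 + L) ^ (κ + 1) := by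
  rcases hκ with ⟨rfl, rfl⟩ | ⟨hne, rfl⟩
  · rw [max_self] at h
    subst h
    refine ⟨1, one_pos, fun L n hL => ?_⟩
    refine (sum_boxLe_le_sum_mul_sum (by linarith) (by linarith) _ _ _ _).trans ?_
    have := sum_filter_mul_le_one_le (A := 2) (by norm_num) hL n
    rw [one_mul, Real.rpow_add (by linarith), Real.rpow_one]
    gcongr <;> simpa using this
  rcases lt_or_gt_of_ne hne with h' | h'
  · rw [max_eq_right h'.le] at h
    simpa using exists_sum_boxLe_le_of_eq_two hβ hA h h'
  · rw [max_eq_left h'.le] at h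
    obtain ⟨C, hC, hC'⟩ := exists_sum_boxLe_le_of_eq_two hβ hB h h'
    refine ⟨C, hC, fun L n hL => ?_⟩
    rw [zero_add, Real.rpow_one, ← sum_boxLe_swap]
    simp only [rate_swap]
    exact hC' L n hL

theorem exists_sum_boxLe_le_of_two_lt_of_lt (hβ : 2 ≤ β) {A B : ℝ} (hB : 2 < B) (h : A < B) :
    ∃ C : ℝ, 0 < C ∧ ∀ (L : ℝ) (n : ℕ),
      ∑ α ∈ boxLe A B L n, rate β ((A - 2) / 2) ((B - 2) / 2) α
        ≤ C * (β : ℝ) ^ ((B - 2) / 2 * L / B) := by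
  apply exists_sum_boxLe_le_of_lt hβ (by linarith) (by linarith)
  -- The condition `(A - 2) / 2 * B < (B - 2) / 2 * A` is equivalent to `A < B`.
  rw [lt_div_iff₀ (by linarith)]
  nlinarith

/-- The corner on an axis with coefficient `A` has weight `β ^ ((A - 2) L / (2 A))`, which increases
with `A`. Hence the larger coefficient dominates, up to the factor `1 + L` in a tie. -/
theorem exists_sum_boxLe_le_of_two_lt_max (hβ : 2 ≤ β) {A B κ : ℝ} (hA : 1 ≤ A)
    (hκ : A = B ∧ κ = 1 ∨ A ≠ B ∧ κ = 0) (h : 2 < max A B) :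
    ∃ C : ℝ, 0 < C ∧ ∀ (L : ℝ) (n : ℕ), 0 ≤ L →
      ∑ α ∈ boxLe A B L n, rate β ((A - 2) / 2) ((B - 2) / 2) α
        ≤ C * (1 + L) ^ κ * (β : ℝ) ^ ((max A B - 2) / 2 * L / max A B) := by
  rcases hκ with ⟨rfl, rfl⟩ | ⟨hne, rfl⟩
  · rw [max_self] at h
    simpa using exists_sum_boxLe_le_of_eq hβ hA (by linarith) (x := (A - 2) / 2)
      (show 0 < (A - 2) / 2 by linarith) (by field_simp)
  rcases lt_or_gt_of_ne hne with h' | h'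
  · rw [max_eq_right h'.le] at h ⊢
    obtain ⟨C, hC, hC'⟩ := exists_sum_boxLe_le_of_two_lt_of_lt hβ h h'
    refine ⟨C, hC, fun L n _ => ?_⟩
    rw [Real.rpow_zero, mul_one]
    exact hC' L n
  · rw [max_eq_left h'.le] at h ⊢
    obtain ⟨C, hC, hC'⟩ := exists_sum_boxLe_le_of_two_lt_of_lt hβ h h'
    refine ⟨C, hC, fun L n _ => ?_⟩
    rw [Real.rpow_zero, mul_one, ← sum_boxLe_swap]
    simp only [rate_swap]
    exact hC' L n

/-- The work of one sample for each index. -/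
theorem exists_sum_boxLe_work_le (hβ : 2 ≤ β) {A B γ : ℝ} (hA : 1 ≤ A) (hB : 1 ≤ B) (hγ : γ ≤ A) :
    ∃ C : ℝ, 0 < C ∧ ∀ (L : ℝ) (n : ℕ), 0 ≤ L →
      ∑ α ∈ boxLe A B L n, rate β γ 1 α ≤ C * (1 + L) ^ (1 : ℝ) * (β : ℝ) ^ L := by
  have hB0 : B ≠ 0 := by positivity
  obtain ⟨C, hC, h⟩ := exists_sum_boxLe_le_of_eq hβ (B := B) hA (x := A) (y := B) (by linarith)
    (by linarith) (by field_simp)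
  refine ⟨C, hC, fun L n hL => ?_⟩
  rw [Real.rpow_one]
  have := h L n hL
  rw [mul_div_cancel_left₀ _ hB0] at this
  -- The work is dominated by `β ^ (A α₁ + B α₂)`, which is at most `β ^ L` on the index set; the
  -- borderline case of equal growth applies to this majorant.
  exact (sum_le_sum fun α _ => rate_le_rate hβ hγ hB α).trans this

/-- Only the first exponent is enlarged to `A`. Since `1 < B`, the weight then decreases along the
line away from the first axis, so the corner there dominates and no factor `1 + L` is lost. -/
theorem exists_sum_boxLe_work_le_of_one_lt (hβ : 2 ≤ β) {A B γ : ℝ} (hA : 1 ≤ A) (hB : 1 < B)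
    (hγ : γ ≤ A) :
    ∃ C : ℝ, 0 < C ∧ ∀ (L : ℝ) (n : ℕ), 0 ≤ L →
      ∑ α ∈ boxLe A B L n, rate β γ 1 α ≤ C * (1 + L) ^ (0 : ℝ) * (β : ℝ) ^ L := by
  have hA0 : A ≠ 0 := by positivity
  obtain ⟨C, hC, h⟩ := exists_sum_boxLe_le_of_lt hβ (A := B) (B := A) (x := 1) (y := A)
    (by linarith) (by linarith) (by rw [lt_div_iff₀ (by linarith)]; nlinarith)
  refine ⟨C, hC, fun L n hL => ?_⟩
  rw [Real.rpow_zero, mul_one]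
  have := h L n
  rw [mul_div_cancel_left₀ _ hA0] at this
  rw [← sum_boxLe_swap]
  simp only [rate_swap]
  exact (sum_le_sum fun α _ => rate_le_rate hβ le_rfl hγ α).trans this

/-! ### The choice of the level and the resulting orders in the tolerance. -/

theorem exists_add_one_mul_exp_neg_le {c δ : ℝ} (hδ : 0 < δ) :
    ∃ D : ℝ, 0 ≤ D ∧ c * (1 + D) * Real.exp (-D) ≤ δ := by
  have h1 : Tendsto (fun D : ℝ => c * (D ^ 0 * Real.exp (-D) + D ^ 1 * Real.exp (-D))) atTop
      (𝓝 (c * (0 + 0))) :=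
    ((Real.tendsto_pow_mul_exp_neg_atTop_nhds_zero 0).add
      (Real.tendsto_pow_mul_exp_neg_atTop_nhds_zero 1)).const_mul c
  rw [add_zero, mul_zero] at h1
  obtain ⟨D, hD, hD0⟩ := ((h1.eventually_lt_const hδ).and (eventually_ge_atTop 0)).exists
  refine ⟨D, hD0, le_of_eq_of_le ?_ hD.le⟩
  rw [pow_zero, pow_one]
  ring

/-- The choice of the level `L` in terms of `ℓ = log tol⁻¹`. -/
theorem exists_level_of_truncation {b η κ δ : ℝ} (hb : 1 < b) (hη : 0 < η) (hκ0 : 0 ≤ κ)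
    (hκ1 : κ ≤ 1) (hδ : 0 < δ) :
    ∃ K : ℝ, 1 ≤ K ∧ ∀ ℓ : ℝ, 1 ≤ ℓ → ∃ L : ℝ, 0 < L ∧
      (1 + L) ^ κ * b ^ (-L / η) ≤ δ * Real.exp (-ℓ) ∧ 1 + L ≤ K * ℓ ∧
      b ^ L ≤ K * Real.exp (η * ℓ) * ℓ ^ (κ * η) := by
  have hlb : 0 < Real.log b := Real.log_pos hb
  have hb0 : 0 < b := by linarith
  set c := 1 + 2 * η / Real.log b with hc
  have hc1 : 1 ≤ c := by rw [hc]; have : 0 < 2 * η / Real.log b := by positivity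
                         linarith
  obtain ⟨D, hD0, hD⟩ := exists_add_one_mul_exp_neg_le (c := c) hδ
  refine ⟨max (c * (1 + D)) (Real.exp (η * D)), le_max_of_le_left (by nlinarith), fun ℓ hℓ => ?_⟩
  have hlog0 : 0 ≤ Real.log ℓ := Real.log_nonneg hℓ
  have hlog1 : Real.log ℓ ≤ ℓ := Real.log_le_self (by linarith)
  have hℓ0 : 0 < ℓ := by linarith
  have hbexp : ∀ x : ℝ, b ^ x = Real.exp (Real.log b * x) := Real.rpow_def_of_pos hb0
  have hℓexp : ∀ x : ℝ, ℓ ^ x = Real.exp (Real.log ℓ * x) := Real.rpow_def_of_pos hℓ0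
  -- With this choice `b ^ (-L / η) = exp (-ℓ) ℓ ^ (-κ) exp (-D)`. The factor `ℓ ^ (-κ)` cancels the
  -- growth of `(1 + L) ^ κ`, and `exp (-D)` beats the constant `c (1 + D)`; this is possible
  -- because `c` does not depend on `D`.
  set L := η * (ℓ + κ * Real.log ℓ + D) / Real.log b with hL
  have hL0 : 0 < L := by positivity
  have hL1 : 1 + L ≤ c * (1 + D) * ℓ := by
    have h1 : κ * Real.log ℓ ≤ ℓ := by nlinarith
    have h2 : L ≤ (2 * η / Real.log b) * ((1 + D) * ℓ) := by
      rw [hL, div_mul_eq_mul_div]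
      refine div_le_div_of_nonneg_right ?_ hlb.le
      have h4 : ℓ + κ * Real.log ℓ + D ≤ 2 * ((1 + D) * ℓ) := by nlinarith
      calc _ ≤ η * (2 * ((1 + D) * ℓ)) := by gcongr
        _ = _ := by ring
    have h3 : 1 ≤ (1 + D) * ℓ := by nlinarith
    rw [hc]; linarith
  refine ⟨L, hL0, ?_, ?_, ?_⟩
  · have e : b ^ (-L / η) = Real.exp (-ℓ) * ℓ ^ (-κ) * Real.exp (-D) := by
      rw [hbexp, hℓexp, ← Real.exp_add, ← Real.exp_add, hL]
      congr 1
      field_simp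
      ring
    have h1 : (1 + L) ^ κ ≤ (c * (1 + D)) * ℓ ^ κ := by
      calc (1 + L) ^ κ ≤ (c * (1 + D) * ℓ) ^ κ := by gcongr
        _ = (c * (1 + D)) ^ κ * ℓ ^ κ := Real.mul_rpow (by positivity) hℓ0.le
        _ ≤ (c * (1 + D)) * ℓ ^ κ := by
          gcongr
          exact Real.rpow_le_self_of_one_le (by nlinarith) hκ1
    have h2 : ℓ ^ κ * ℓ ^ (-κ) = 1 := by rw [← Real.rpow_add hℓ0]; simp
    calc (1 + L) ^ κ * b ^ (-L / η)
        ≤ (c * (1 + D)) * ℓ ^ κ * (Real.exp (-ℓ) * ℓ ^ (-κ) * Real.exp (-D)) := by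
          rw [e]; gcongr
      _ = c * (1 + D) * Real.exp (-D) * Real.exp (-ℓ) * (ℓ ^ κ * ℓ ^ (-κ)) := by ring
      _ ≤ δ * Real.exp (-ℓ) := by rw [h2, mul_one]; gcongr
  · exact hL1.trans (by gcongr; exact le_max_left _ _)
  · have e : b ^ L = Real.exp (η * D) * Real.exp (η * ℓ) * ℓ ^ (κ * η) := by
      rw [hbexp, hℓexp, ← Real.exp_add, ← Real.exp_add, hL]
      congr 1
      field_simp
      ring
    rw [e]
    gcongr
    exact le_max_right _ _

theorem exists_rpow_le_mul_exp (m : ℝ) {δ : ℝ} (hδ : 0 < δ) :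
    ∃ K : ℝ, 0 < K ∧ ∀ ℓ : ℝ, 1 ≤ ℓ → ℓ ^ m ≤ K * Real.exp (δ * ℓ) := by
  set c := max m 1 / δ with hc
  have hm : 0 < max m 1 := by positivity
  have hc0 : 0 < c := by positivity
  refine ⟨c ^ max m 1, by positivity, fun ℓ hℓ => ?_⟩
  have h1 : ℓ / c ≤ Real.exp (ℓ / c) := by linarith [Real.add_one_le_exp (ℓ / c)]
  calc ℓ ^ m ≤ ℓ ^ max m 1 := Real.rpow_le_rpow_of_exponent_le hℓ (le_max_left _ _)
    _ = c ^ max m 1 * (ℓ / c) ^ max m 1 := by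
        rw [← Real.mul_rpow (by positivity) (by positivity), mul_div_cancel₀ _ hc0.ne']
    _ ≤ c ^ max m 1 * (Real.exp (ℓ / c)) ^ max m 1 := by gcongr
    _ = c ^ max m 1 * Real.exp (δ * ℓ) := by
        rw [← Real.exp_mul, hc]
        congr 2
        field_simp

/-- The two sums that determine the work, at a level chosen according to the truncation error. -/
theorem exists_level_work (hβ : 2 ≤ β) {A B γ κ p δ : ℝ} (hA : 1 ≤ A) (hB : 1 ≤ B) (hγ : γ ≤ A)
    (hκ : A = B ∧ κ = 1 ∨ A ≠ B ∧ κ = 0)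
    (hp : max A B < 2 ∧ p = 0 ∨ max A B = 2 ∧ p = 2 * (κ + 1) ∨
      2 < max A B ∧ (1 < B ∧ p = κ * max A B ∨ p = 1 + κ * max A B)) (hδ : 0 < δ) :
    ∃ K : ℝ, 0 < K ∧ ∀ ℓ : ℝ, 1 ≤ ℓ → ∃ L : ℝ, 0 < L ∧
      (∀ n, ∑ α ∈ boxGt A B L n, rate β (-1) (-1) α ≤ δ * Real.exp (-ℓ)) ∧
      (∀ n, (∑ α ∈ boxLe A B L n, rate β ((A - 2) / 2) ((B - 2) / 2) α) ^ 2
        ≤ K * Real.exp (max 0 (max A B - 2) * ℓ) * ℓ ^ p) ∧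
      (∀ n, ∑ α ∈ boxLe A B L n, rate β γ 1 α
        ≤ K * Real.exp ((2 + max 0 (max A B - 2)) * ℓ) * ℓ ^ p) := by
  have hb : (1 : ℝ) < β := by exact_mod_cast (by omega : 1 < β)
  have hb0 : (0 : ℝ) < β := by linarith
  have hκ01 : 0 ≤ κ ∧ κ ≤ 1 := by rcases hκ with ⟨_, rfl⟩ | ⟨_, rfl⟩ <;> norm_num
  obtain ⟨CT, hCT, hT⟩ := exists_sum_boxGt_le hβ hA hB hκ
  set η := max A B with hηdef
  have hη : 0 < η := lt_max_of_lt_left (by linarith)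
  obtain ⟨K, hK, hlev⟩ := exists_level_of_truncation hb hη hκ01.1 hκ01.2 (div_pos hδ hCT)
  have hK0 : 0 < K := by linarith
  suffices hmain : ∃ C : ℝ, 0 < C ∧ ∀ ℓ L : ℝ, 1 ≤ ℓ → 0 < L → 1 + L ≤ K * ℓ →
      (β : ℝ) ^ L ≤ K * Real.exp (η * ℓ) * ℓ ^ (κ * η) →
      (∀ n, (∑ α ∈ boxLe A B L n, rate β ((A - 2) / 2) ((B - 2) / 2) α) ^ 2
        ≤ C * Real.exp (max 0 (η - 2) * ℓ) * ℓ ^ p) ∧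
      (∀ n, ∑ α ∈ boxLe A B L n, rate β γ 1 α
        ≤ C * Real.exp ((2 + max 0 (η - 2)) * ℓ) * ℓ ^ p) by
    obtain ⟨C, hC, h⟩ := hmain
    refine ⟨C, hC, fun ℓ hℓ => ?_⟩
    obtain ⟨L, hL, h1, h2, h3⟩ := hlev ℓ hℓ
    refine ⟨L, hL, fun n => (hT L n hL.le).trans ?_, h ℓ L hℓ hL h2 h3⟩
    rw [mul_assoc]
    calc _ ≤ CT * (δ / CT * Real.exp (-ℓ)) := by gcongr
      _ = _ := by field_simp
  have hS0 : ∀ L n, 0 ≤ ∑ α ∈ boxLe A B L n, rate β ((A - 2) / 2) ((B - 2) / 2) α :=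
    fun L n => sum_nonneg fun α _ => (rate_pos hβ _ _ α).le
  obtain ⟨CW, hCW, hW⟩ := exists_sum_boxLe_work_le hβ hA hB hγ
  rcases hp with ⟨hlt, rfl⟩ | ⟨heq, rfl⟩ | ⟨hgt, hp⟩
  · obtain ⟨CS, hCS, hS⟩ := exists_sum_boxLe_le_of_max_lt_two hβ hA hB hlt
    -- For `η < 2` the rounding term is of order `exp (η ℓ)` times a power of `ℓ`. The gap `2 - η`
    -- absorbs that power, so no logarithm survives.
    obtain ⟨Ke, hKe, he⟩ := exists_rpow_le_mul_exp (1 + κ * η) (sub_pos.2 hlt)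
    rw [max_eq_left (by linarith)]
    refine ⟨max (CS ^ 2) (CW * K * K * Ke), by positivity, fun ℓ L hℓ hL h2 h3 => ⟨fun n => ?_,
      fun n => ?_⟩⟩
    · rw [zero_mul, Real.exp_zero, Real.rpow_zero, mul_one, mul_one]
      refine le_trans ?_ (le_max_left _ _)
      exact pow_le_pow_left₀ (hS0 L n) (hS L n) 2
    · calc _ ≤ CW * (1 + L) ^ (1 : ℝ) * (β : ℝ) ^ L := hW L n hL.le
        _ ≤ CW * (K * ℓ) * (K * Real.exp (η * ℓ) * ℓ ^ (κ * η)) := by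
            rw [Real.rpow_one]; gcongr
        _ = CW * K * K * Real.exp (η * ℓ) * ℓ ^ (1 + κ * η) := by
            rw [Real.rpow_add (by linarith), Real.rpow_one]; ring
        _ ≤ CW * K * K * Real.exp (η * ℓ) * (Ke * Real.exp ((2 - η) * ℓ)) := by
            gcongr; exact he ℓ hℓ
        _ = CW * K * K * Ke * Real.exp ((2 + 0) * ℓ) * ℓ ^ (0 : ℝ) := by
            rw [show (2 + 0) * ℓ = η * ℓ + (2 - η) * ℓ by ring, Real.exp_add, Real.rpow_zero]
            ring
        _ ≤ _ := by gcongr; exact le_max_right _ _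
  · obtain ⟨CS, hCS, hS⟩ := exists_sum_boxLe_le_of_max_eq_two hβ hA hB hκ heq
    rw [heq, sub_self, max_self]
    refine ⟨max ((CS * K ^ (κ + 1)) ^ 2) (CW * K * K), by positivity,
      fun ℓ L hℓ hL h2 h3 => ⟨fun n => ?_, fun n => ?_⟩⟩
    · have hℓ0 : 0 < ℓ := by linarith
      rw [zero_mul, Real.exp_zero, mul_one]
      calc _ ≤ (CS * (K * ℓ) ^ (κ + 1)) ^ 2 := by
            apply pow_le_pow_left₀ (hS0 L n)
            refine (hS L n hL.le).trans ?_
            have : 0 ≤ κ + 1 := by linarith [hκ01.1]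
            gcongr
        _ = (CS * K ^ (κ + 1)) ^ 2 * ℓ ^ (2 * (κ + 1)) := by
            rw [Real.mul_rpow hK0.le hℓ0.le, mul_comm 2 (κ + 1), Real.rpow_mul hℓ0.le,
              Real.rpow_two]
            ring
        _ ≤ _ := by gcongr; exact le_max_left _ _
    · have hℓ0 : 0 < ℓ := by linarith
      calc _ ≤ CW * (1 + L) ^ (1 : ℝ) * (β : ℝ) ^ L := hW L n hL.le
        _ ≤ CW * (K * ℓ) * (K * Real.exp (η * ℓ) * ℓ ^ (κ * η)) := by
            rw [Real.rpow_one, heq]; gcongr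
        _ = CW * K * K * Real.exp ((2 + 0) * ℓ) * ℓ ^ (1 + κ * η) := by
            rw [heq, Real.rpow_add hℓ0, Real.rpow_one, add_zero, mul_comm κ 2]; ring
        _ ≤ _ := by
            rw [heq]
            gcongr
            · exact le_max_right _ _
            -- The rounding term has the log exponent `1 + 2κ`, below the exponent `2 (κ + 1)` of
            -- the squared sum.
            · linarith
  · obtain ⟨CS, hCS, hS⟩ := exists_sum_boxLe_le_of_two_lt_max hβ hA hκ hgt
    -- For `η > 2` the rounding term has the same order in `tol` as the main term, so its factor `(1
    -- + L) ^ τ` is visible: `τ = 0` if `1 < B`, and `τ = 1` otherwise.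
    have hτ : ∃ τ, 0 ≤ τ ∧ p = κ * η + τ ∧ ∃ C : ℝ, 0 < C ∧ ∀ (L : ℝ) (n : ℕ), 0 ≤ L →
        ∑ α ∈ boxLe A B L n, rate β γ 1 α ≤ C * (1 + L) ^ τ * (β : ℝ) ^ L := by
      rcases hp with ⟨hB1, rfl⟩ | rfl
      · exact ⟨0, le_rfl, (add_zero _).symm, exists_sum_boxLe_work_le_of_one_lt hβ hA hB1 hγ⟩
      · exact ⟨1, zero_le_one, add_comm _ _, CW, hCW, hW⟩
    obtain ⟨τ, hτ0, rfl, CW, hCW, hW⟩ := hτ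
    rw [max_eq_right (a := (0 : ℝ)) (b := η - 2) (by linarith), add_sub_cancel]
    refine ⟨max ((CS * K ^ κ) ^ 2 * K ^ ((η - 2) / η)) (CW * K ^ τ * K), by positivity,
      fun ℓ L hℓ hL h2 h3 => ⟨fun n => ?_, fun n => ?_⟩⟩
    · have hℓ0 : 0 < ℓ := by linarith
      have hθ : 0 ≤ (η - 2) / η := div_nonneg (by linarith) hη.le
      have e1 : ((β : ℝ) ^ ((η - 2) / 2 * L / η)) ^ 2 = ((β : ℝ) ^ L) ^ ((η - 2) / η) := by
        rw [← Real.rpow_two, ← Real.rpow_mul hb0.le, ← Real.rpow_mul hb0.le]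
        congr 1
        field_simp
      have e2 : (K * Real.exp (η * ℓ) * ℓ ^ (κ * η)) ^ ((η - 2) / η)
          = K ^ ((η - 2) / η) * Real.exp ((η - 2) * ℓ) * ℓ ^ (κ * (η - 2)) := by
        rw [Real.mul_rpow (by positivity) (by positivity), Real.mul_rpow hK0.le (by positivity),
          ← Real.exp_mul, ← Real.rpow_mul hℓ0.le]
        rw [show η * ℓ * ((η - 2) / η) = (η - 2) * ℓ by field_simp,
          show κ * η * ((η - 2) / η) = κ * (η - 2) by field_simp]
      calc _ ≤ (CS * (1 + L) ^ κ * (β : ℝ) ^ ((η - 2) / 2 * L / η)) ^ 2 :=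
            pow_le_pow_left₀ (hS0 L n) (hS L n hL.le) 2
        _ = (CS * (1 + L) ^ κ) ^ 2 * ((β : ℝ) ^ L) ^ ((η - 2) / η) := by rw [mul_pow, e1]
        _ ≤ (CS * (K * ℓ) ^ κ) ^ 2 * (K * Real.exp (η * ℓ) * ℓ ^ (κ * η)) ^ ((η - 2) / η) := by
            gcongr
            exact hκ01.1
        -- The log exponents add up: `2κ` from `(1 + L) ^ (2κ)` and `κ (η - 2)` from the power of `β
        -- ^ L` make `κ η`.
        _ = (CS * K ^ κ) ^ 2 * K ^ ((η - 2) / η) * Real.exp ((η - 2) * ℓ) * ℓ ^ (κ * η) := by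
            rw [e2, Real.mul_rpow hK0.le hℓ0.le, show κ * η = κ + κ + κ * (η - 2) by ring,
              Real.rpow_add hℓ0, Real.rpow_add hℓ0]
            ring
        _ ≤ _ := by
            gcongr
            · exact le_max_left _ _
            · linarith
    · have hℓ0 : 0 < ℓ := by linarith
      calc _ ≤ CW * (1 + L) ^ τ * (β : ℝ) ^ L := hW L n hL.le
        _ ≤ CW * (K * ℓ) ^ τ * (K * Real.exp (η * ℓ) * ℓ ^ (κ * η)) := by gcongr
        _ = CW * K ^ τ * K * Real.exp (η * ℓ) * ℓ ^ (κ * η + τ) := by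
            rw [Real.mul_rpow hK0.le hℓ0.le, Real.rpow_add hℓ0]; ring
        _ ≤ _ := by gcongr; exact le_max_right _ _

/-! ### The level sets and their optimality. -/

theorem summable_rate (hβ : 2 ≤ β) {x y : ℝ} (hx : x < 0) (hy : y < 0) :
    Summable (rate β x y) := by
  have hb : (1 : ℝ) < β := by exact_mod_cast (by omega : 1 < β)
  have hb0 : (0 : ℝ) < β := by linarith
  have h : ∀ z : ℝ, z < 0 → Summable fun i : ℕ => ((β : ℝ) ^ i) ^ z := fun z hz => by
    simp only [pow_rpow_eq_rpow_pow hb0.le]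
    exact summable_geometric_of_lt_one (by positivity) (Real.rpow_lt_one_of_one_lt_of_neg hb hz)
  exact (h x hx).mul_of_nonneg (h y hy) (fun _ => by positivity) (fun _ => by positivity)

/-- The indices with `A α₁ + B α₂ ≤ L`. -/
noncomputable def levelFinset (A B L : ℝ) : Finset (ℕ × ℕ) := boxLe A B L (⌊L⌋₊ + 1)

theorem mem_levelFinset {A B L : ℝ} (hA : 1 ≤ A) (hB : 1 ≤ B) {α : ℕ × ℕ} :
    α ∈ levelFinset A B L ↔ A * α.1 + B * α.2 ≤ L := by
  simp only [levelFinset, boxLe, mem_filter, mem_product, Finset.mem_range, and_iff_right_iff_imp]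
  intro h
  have h1 : (α.1 : ℝ) ≤ A * α.1 := le_mul_of_one_le_left (Nat.cast_nonneg _) hA
  have h2 : (α.2 : ℝ) ≤ B * α.2 := le_mul_of_one_le_left (Nat.cast_nonneg _) hB
  have h3 : (0 : ℝ) ≤ α.1 := Nat.cast_nonneg _
  have h4 : (0 : ℝ) ≤ α.2 := Nat.cast_nonneg _
  exact ⟨Nat.lt_succ_of_le (Nat.le_floor (by linarith)),
    Nat.lt_succ_of_le (Nat.le_floor (by linarith))⟩

theorem coe_levelFinset {γP sP sN L : ℝ} (hA : 1 ≤ 1 - sP + γP) (hB : 1 ≤ 3 - sN) :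
    (levelFinset (1 - sP + γP) (3 - sN) L : Set (ℕ × ℕ)) = indexSet γP sP sN L := by
  ext α
  exact mem_levelFinset hA hB

/-- An index set that collects the indices whose ratio of error to `√(variance · work)` is
above a threshold is optimal. -/
theorem isOptimalIndexSet_of_threshold {err var work s : ℕ × ℕ → ℝ} (herr : ∀ α, 0 < err α)
    (hvar : ∀ α, 0 < var α) (hwork : ∀ α, 0 < work α) (hs : ∀ α, 0 < s α)
    (hsq : ∀ α, s α ^ 2 = var α * work α) (hsum : Summable err) {τ : ℝ} (hτ : 0 < τ)
    {I : Finset (ℕ × ℕ)} (hI : I.Nonempty) (hmem : ∀ α, α ∈ I ↔ τ * s α ≤ err α) :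
    IsOptimalIndexSet err var work (I : Set (ℕ × ℕ)) := by
  classical
  refine ⟨I, rfl, fun J hJ hle v hv M hM hMv => ?_⟩
  have hIJ : ∑ α ∈ I, err α ≤ ∑ α ∈ J, err α := by
    have h1 := hsum.sum_add_tsum_subtype_compl I
    have h2 := hsum.sum_add_tsum_subtype_compl J
    linarith
  have hdiff : ∀ f : ℕ × ℕ → ℝ, ∑ α ∈ J, f α - ∑ α ∈ I, f α
      = ∑ α ∈ J \ I, f α - ∑ α ∈ I \ J, f α := fun f => by
    rw [← sum_sdiff_sub_sum_sdiff]
  -- Otherwise `J` is a proper subset of `I` and its truncation error is strictly larger.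
  have hne : (J \ I).Nonempty := by
    by_contra hempty
    rw [not_nonempty_iff_eq_empty] at hempty
    have h2 := hdiff err
    rw [hempty, sum_empty] at h2
    have h3 : (I \ J).Nonempty := by
      by_contra h
      rw [not_nonempty_iff_eq_empty] at h
      exact hJ (subset_antisymm (sdiff_eq_empty_iff_subset.1 hempty) (sdiff_eq_empty_iff_subset.1 h))
    have h4 : 0 < ∑ α ∈ I \ J, err α := sum_pos (fun α _ => herr α) h3
    linarith
  -- Exchange argument: `J \ I` must capture at least the error of `I \ J`, but each unit of error
  -- costs more than `1 / τ` in `s` there and at most `1 / τ` on `I \ J`.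
  have hlt : ∑ α ∈ I, s α < ∑ α ∈ J, s α := by
    have h1 : ∑ α ∈ J \ I, err α < ∑ α ∈ J \ I, τ * s α := by
      apply sum_lt_sum_of_nonempty hne
      intro α hα
      rw [Finset.mem_sdiff, hmem, not_le] at hα
      exact hα.2
    have h2 : ∑ α ∈ I \ J, τ * s α ≤ ∑ α ∈ I \ J, err α := by
      apply sum_le_sum
      intro α hα
      rw [Finset.mem_sdiff, hmem] at hα
      exact hα.1
    have h3 := hdiff err
    have h4 := hdiff s
    rw [← mul_sum] at h1 h2
    have h5 : τ * ∑ α ∈ I \ J, s α < τ * ∑ α ∈ J \ I, s α := by linarith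
    have h6 := lt_of_mul_lt_mul_left h5 hτ.le
    linarith
  set SI := ∑ α ∈ I, s α with hSI
  have hSI0 : 0 < SI := sum_pos (fun α _ => hs α) hI
  -- The Lagrange optimum: `s / work = √(var / work)`, scaled so that the variance is exactly `v`.
  -- Its work `SI² / v` is compared with the Cauchy-Schwarz lower bound for `J`.
  refine ⟨fun α => s α / work α * (SI / v), fun α _ => ?_, ?_, ?_⟩
  · have := hs α
    have := hwork α
    positivity
  · refine le_of_eq ?_
    calc _ = ∑ α ∈ I, s α * (v / SI) := by
          apply sum_congr rfl
          intro α _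
          have h1 := (hs α).ne'
          have h2 := (hwork α).ne'
          field_simp
          exact (hsq α).symm
      _ = v := by rw [← sum_mul, ← hSI]; field_simp
  · have hCS : (∑ α ∈ J, s α) ^ 2 ≤ (∑ α ∈ J, var α / M α) * ∑ α ∈ J, M α * work α := by
      apply sum_sq_le_sum_mul_sum_of_sq_le_mul
      · intro α hα
        exact (div_pos (hvar α) (hM α hα)).le
      · intro α hα
        exact (mul_pos (hM α hα) (hwork α)).le
      · intro α hα
        have := (hM α hα).ne'
        refine le_of_eq ?_
        rw [hsq]
        field_simp
    have hW : 0 ≤ ∑ α ∈ J, M α * work α :=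
      sum_nonneg fun α hα => (mul_pos (hM α hα) (hwork α)).le
    calc _ = SI ^ 2 / v := by
          rw [sq, mul_div_assoc, hSI, sum_mul, ← hSI]
          apply sum_congr rfl
          intro α _
          have h2 := (hwork α).ne'
          field_simp
      _ < (∑ α ∈ J, s α) ^ 2 / v := by gcongr
      _ ≤ (v * ∑ α ∈ J, M α * work α) / v := by
          gcongr
          exact hCS.trans (by gcongr)
      _ = _ := by field_simp

theorem isOptimalIndexSet_indexSet (hβ : 2 ≤ β) {γP sP sN c₁ c₂ c₃ L : ℝ} (hA : 1 ≤ 1 - sP + γP)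
    (hB : 1 ≤ 3 - sN) (h₁ : 0 < c₁) (h₂ : 0 < c₂) (h₃ : 0 < c₃) (hL : 0 < L) :
    IsOptimalIndexSet (fun α => c₁ * rate β (-1) (-1) α)
      (fun α => c₂ * rate β (-sP - 1) (-sN) α) (fun α => c₃ * rate β γP 1 α)
      (indexSet γP sP sN L) := by
  have hb : (1 : ℝ) < β := by exact_mod_cast (by omega : 1 < β)
  have hb0 : (0 : ℝ) < β := by linarith
  rw [← coe_levelFinset hA hB]
  have hc : 0 < c₂ * c₃ := mul_pos h₂ h₃
  refine isOptimalIndexSet_of_threshold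
    (s := fun α => √(c₂ * c₃) * rate β ((γP - sP - 1) / 2) ((1 - sN) / 2) α)
    -- This is the value of `err / s` on the line `A α₁ + B α₂ = L`.
    (τ := c₁ / √(c₂ * c₃) * (β : ℝ) ^ (-L / 2))
    (fun α => mul_pos h₁ (rate_pos hβ _ _ _)) (fun α => mul_pos h₂ (rate_pos hβ _ _ _))
    (fun α => mul_pos h₃ (rate_pos hβ _ _ _))
    (fun α => mul_pos (Real.sqrt_pos.2 hc) (rate_pos hβ _ _ _)) (fun α => ?_)
    ((summable_rate hβ (by norm_num) (by norm_num)).mul_left _) (by positivity)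
    ⟨(0, 0), (mem_levelFinset hA hB).2 (by simpa using hL.le)⟩ (fun α => ?_)
  · rw [mul_pow, Real.sq_sqrt hc.le, sq, rate_mul hβ, mul_mul_mul_comm, rate_mul hβ]
    congr 2 <;> ring
  · have hr := rate_pos hβ ((γP - sP - 1) / 2) ((1 - sN) / 2) α
    have hsq := Real.sqrt_pos.2 hc
    rw [mem_levelFinset hA hB]
    have e : c₁ / √(c₂ * c₃) * (β : ℝ) ^ (-L / 2) *
        (√(c₂ * c₃) * rate β ((γP - sP - 1) / 2) ((1 - sN) / 2) α)
        = c₁ * (β : ℝ) ^ (-L / 2 + ((γP - sP - 1) / 2 * α.1 + (1 - sN) / 2 * α.2)) := by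
      rw [Real.rpow_add hb0, ← rate_eq_rpow hβ]
      field_simp
    rw [e, mul_le_mul_iff_right₀ h₁, rate_eq_rpow hβ, Real.rpow_le_rpow_left_iff hb]
    constructor <;> intro h <;> linarith

end Sums

/-! ### Joint laws and independence of tuples of samples. -/

section Samples

variable {Ω Ω₀ ι : Type*} [MeasurableSpace Ω] [MeasurableSpace Ω₀] {Pr : Measure Ω}
  {μ : Measure Ω₀} {smp : ι → Ω → Ω₀}

theorem measurePreserving_pi_of_iIndepFun [IsProbabilityMeasure Pr] (hm : ∀ i, Measurable (smp i))
    (hlaw : ∀ i, Pr.map (smp i) = μ) (hind : iIndepFun smp Pr) {n : ℕ} {f : Fin n → ι}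
    (hf : f.Injective) :
    MeasurePreserving (fun w q => smp (f q) w) Pr (Measure.pi fun _ : Fin n => μ) := by
  refine ⟨measurable_pi_iff.2 fun q => hm _, ?_⟩
  have h := (iIndepFun_iff_map_fun_eq_pi_map (fun q => (hm (f q)).aemeasurable)).1
    (hind.precomp hf)
  rw [h]
  simp only [hlaw]

theorem measurePreserving_pi_comp [IsProbabilityMeasure μ] {n m : ℕ} {f : Fin n → Fin m} (hf : f.Injective) :
    MeasurePreserving (fun (ω : Fin m → Ω₀) q => ω (f q)) (Measure.pi fun _ => μ)
      (Measure.pi fun _ => μ) :=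
  measurePreserving_pi_of_iIndepFun (smp := fun (i : Fin m) (ω : Fin m → Ω₀) => ω i)
    (fun i => measurable_pi_apply i) (fun i => (measurePreserving_eval (fun _ => μ) i).map_eq)
    (iIndepFun_pi (X := fun _ => id) fun _ => aemeasurable_id) hf

theorem indepFun_tuple (hm : ∀ i, Measurable (smp i)) (hind : iIndepFun smp Pr) {n m : ℕ}
    {f : Fin n → ι} {g : Fin m → ι} (hfg : ∀ i j, f i ≠ g j) :
    IndepFun (fun w q => smp (f q) w) (fun w q => smp (g q) w) Pr := by
  classical
  have hdisj : Disjoint (univ.image f) (univ.image g) := by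
    rw [disjoint_left]
    intro i hi hj
    simp only [mem_image, mem_univ, true_and] at hi hj
    obtain ⟨a, rfl⟩ := hi
    obtain ⟨b, hb⟩ := hj
    exact hfg a b hb.symm
  have h := hind.indepFun_finset _ _ hdisj hm
  exact h.comp
    (φ := fun (z : univ.image f → Ω₀) (q : Fin n) => z ⟨f q, mem_image_of_mem f (mem_univ q)⟩)
    (ψ := fun (z : univ.image g → Ω₀) (q : Fin m) => z ⟨g q, mem_image_of_mem g (mem_univ q)⟩)
    (measurable_pi_iff.2 fun q => measurable_pi_apply _)
    (measurable_pi_iff.2 fun q => measurable_pi_apply _)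

end Samples

/-! ### Mean and variance of the estimator. -/

section Estimator

/-- Flattening the double sum allows the variance formula for pairwise independent summands to be
applied once, across indices and samples together. -/
theorem estimator_eq_sum {Ω Ω₀ : Type*} {β : ℕ} (Δ : (α : ℕ × ℕ) → (Fin (β ^ α.1) → Ω₀) → ℝ)
    (smp : (ℕ × ℕ) × ℕ × ℕ → Ω → Ω₀) (I : Finset (ℕ × ℕ)) (M : ℕ × ℕ → ℕ) :
    estimator Δ smp I M = ∑ p ∈ I.sigma fun α => range (M α), fun w =>
      (1 / (M p.1 : ℝ)) * Δ p.1 (fun q => smp (p.1, p.2, (q : ℕ)) w) := by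
  ext w
  rw [Finset.sum_apply, sum_sigma]
  simp only [estimator, mul_sum]

variable {Ω Ω₀ : Type*} [MeasurableSpace Ω] [MeasurableSpace Ω₀] {Pr : Measure Ω}
  [IsProbabilityMeasure Pr] {μ : Measure Ω₀}
  {smp : (ℕ × ℕ) × ℕ × ℕ → Ω → Ω₀} {β : ℕ} {Δ : (α : ℕ × ℕ) → (Fin (β ^ α.1) → Ω₀) → ℝ}

theorem measurePreserving_sample (hm : ∀ i, Measurable (smp i)) (hlaw : ∀ i, Pr.map (smp i) = μ)
    (hind : iIndepFun smp Pr) (α : ℕ × ℕ) (m : ℕ) :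
    MeasurePreserving (fun w (q : Fin (β ^ α.1)) => smp (α, m, (q : ℕ)) w) Pr
      (Measure.pi fun _ => μ) :=
  measurePreserving_pi_of_iIndepFun hm hlaw hind (f := fun q => (α, m, (q : ℕ)))
    fun p q h => by simpa [Fin.ext_iff] using h

theorem memLp_estimator (hm : ∀ i, Measurable (smp i)) (hlaw : ∀ i, Pr.map (smp i) = μ)
    (hind : iIndepFun smp Pr) (hΔ : ∀ α, MemLp (Δ α) 2 (Measure.pi fun _ => μ))
    (I : Finset (ℕ × ℕ)) (M : ℕ × ℕ → ℕ) : MemLp (estimator Δ smp I M) 2 Pr := by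
  rw [estimator_eq_sum]
  refine memLp_finsetSum' _ fun p _ => MemLp.const_mul ?_ _
  exact (hΔ p.1).comp_measurePreserving (measurePreserving_sample hm hlaw hind p.1 p.2)

theorem integral_estimator (hm : ∀ i, Measurable (smp i)) (hlaw : ∀ i, Pr.map (smp i) = μ)
    (hind : iIndepFun smp Pr) (hΔ : ∀ α, MemLp (Δ α) 2 (Measure.pi fun _ => μ))
    (I : Finset (ℕ × ℕ)) {M : ℕ × ℕ → ℕ} (hM : ∀ α ∈ I, 0 < M α) :
    ∫ w, estimator Δ smp I M w ∂Pr = ∑ α ∈ I, ∫ ω, Δ α ω ∂(Measure.pi fun _ => μ) := by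
  have hmp := fun α m => measurePreserving_sample (β := β) hm hlaw hind α m
  have hint : ∀ α m, Integrable (fun w => Δ α (fun q => smp (α, m, (q : ℕ)) w)) Pr := fun α m =>
    ((hΔ α).comp_measurePreserving (hmp α m)).integrable one_le_two
  have heq : ∀ α m, ∫ w, Δ α (fun q => smp (α, m, (q : ℕ)) w) ∂Pr
      = ∫ ω, Δ α ω ∂(Measure.pi fun _ => μ) := fun α m => by
    rw [← (hmp α m).map_eq, integral_map (hmp α m).aemeasurable]
    rw [(hmp α m).map_eq]
    exact (hΔ α).1
  unfold estimator
  rw [integral_finsetSum _ fun α _ => (integrable_finsetSum _ fun m _ => hint α m).const_mul _]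
  refine sum_congr rfl fun α hα => ?_
  have : (M α : ℝ) ≠ 0 := by exact_mod_cast (hM α hα).ne'
  rw [integral_const_mul, integral_finsetSum _ fun m _ => hint α m]
  simp only [heq, sum_const, card_range, nsmul_eq_mul]
  field_simp

theorem variance_estimator (hm : ∀ i, Measurable (smp i)) (hlaw : ∀ i, Pr.map (smp i) = μ)
    (hind : iIndepFun smp Pr) (hΔ : ∀ α, MemLp (Δ α) 2 (Measure.pi fun _ => μ))
    (I : Finset (ℕ × ℕ)) {M : ℕ × ℕ → ℕ} (hM : ∀ α ∈ I, 0 < M α) :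
    variance (estimator Δ smp I M) Pr
      = ∑ α ∈ I, variance (Δ α) (Measure.pi fun _ => μ) / M α := by
  have hmp := fun α m => measurePreserving_sample (β := β) hm hlaw hind α m
  have hL2 : ∀ α m, MemLp (fun w => Δ α (fun q => smp (α, m, (q : ℕ)) w)) 2 Pr := fun α m =>
    (hΔ α).comp_measurePreserving (hmp α m)
  rw [estimator_eq_sum, IndepFun.variance_sum (fun p _ => (hL2 p.1 p.2).const_mul _), sum_sigma]
  · refine sum_congr rfl fun α hα => ?_
    have : (M α : ℝ) ≠ 0 := by exact_mod_cast (hM α hα).ne'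
    simp only [variance_const_mul, (hmp _ _).variance_fun_comp (hΔ _).1.aemeasurable, sum_const,
      card_range, nsmul_eq_mul]
    field_simp
  · intro p _ p' _ hpp
    -- Distinct pairs `(α, m)` use disjoint blocks of the independent inputs.
    have h := indepFun_tuple hm hind (f := fun q : Fin (β ^ p.1.1) => (p.1, p.2, (q : ℕ)))
      (g := fun q : Fin (β ^ p'.1.1) => (p'.1, p'.2, (q : ℕ))) (fun i j hij => hpp (by
        simp only [Prod.mk.injEq] at hij
        exact Sigma.ext hij.1 (heq_of_eq hij.2.1)))
    refine h.comp₀ (φ := fun z => (1 / (M p.1 : ℝ)) * Δ p.1 z)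
      (ψ := fun z => (1 / (M p'.1 : ℝ)) * Δ p'.1 z) (hmp _ _).aemeasurable (hmp _ _).aemeasurable
      ?_ ?_
    · rw [(hmp _ _).map_eq]
      exact (hΔ _).1.aemeasurable.const_mul _
    · rw [(hmp _ _).map_eq]
      exact (hΔ _).1.aemeasurable.const_mul _

end Estimator

/-! ### Telescoping of the means and the bias. -/

namespace ParticleSystem

variable {d : ℕ} {Θ Ω₀ : Type*} [MeasurableSpace Ω₀] {S : ParticleSystem d Θ Ω₀}
  {μ : Measure Ω₀} [IsProbabilityMeasure μ] {sch : Scheme d Ω₀} {β : ℕ} {vphi : Sampler β Ω₀}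

theorem memLp_levelDiff (hS : S.SquareIntegrable μ sch β) (hv : S.IsSampler μ sch β vphi)
    (k i : ℕ) : MemLp (S.levelDiff sch β vphi (β ^ k) i) 2 (Measure.pi fun _ => μ) := by
  cases i with
  | zero => exact hS (0, k)
  | succ i => exact (hS (i + 1, k)).sub (hv i k).1

theorem memLp_mixedDiff (hS : S.SquareIntegrable μ sch β) (hv : S.IsSampler μ sch β vphi)
    (α : ℕ × ℕ) : MemLp (S.mixedDiff sch β vphi α) 2 (Measure.pi fun _ => μ) := by
  obtain ⟨i, k⟩ := α
  cases k with
  | zero => exact memLp_levelDiff hS hv 0 i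
  | succ k => exact (memLp_levelDiff hS hv (k + 1) i).sub (memLp_levelDiff hS hv k i)

/-- The sampler has the mean of the coarse system, so it cancels the preceding term; its coupling to
the fine system does not affect the mean. -/
theorem sum_integral_levelDiff (hS : S.SquareIntegrable μ sch β) (hv : S.IsSampler μ sch β vphi)
    (k n : ℕ) :
    ∑ i ∈ range (n + 1), ∫ ω, S.levelDiff sch β vphi (β ^ k) i ω ∂(Measure.pi fun _ => μ)
      = ∫ ω, S.phi sch (β ^ n) (β ^ k) ω ∂(Measure.pi fun _ => μ) := by
  induction n with
  | zero => simp [levelDiff]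
  | succ n ih =>
    rw [sum_range_succ, ih]
    simp only [levelDiff]
    rw [integral_sub ((hS (n + 1, k)).integrable one_le_two) ((hv n k).1.integrable one_le_two),
      (hv n k).2]
    ring

theorem sum_integral_mixedDiff (hS : S.SquareIntegrable μ sch β) (hv : S.IsSampler μ sch β vphi)
    (n k : ℕ) :
    ∑ α ∈ range (n + 1) ×ˢ range (k + 1),
        ∫ ω, S.mixedDiff sch β vphi α ω ∂(Measure.pi fun _ => μ)
      = ∫ ω, S.phi sch (β ^ n) (β ^ k) ω ∂(Measure.pi fun _ => μ) := by
  rw [sum_product, ← sum_integral_levelDiff hS hv]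
  refine sum_congr rfl fun i _ => ?_
  induction k with
  | zero => simp [mixedDiff]
  | succ k ih =>
    rw [sum_range_succ, ih]
    simp only [mixedDiff]
    rw [integral_sub ((memLp_levelDiff hS hv (k + 1) i).integrable one_le_two)
      ((memLp_levelDiff hS hv k i).integrable one_le_two)]
    ring

/-- The bias of the sum over a finite index set is bounded by the sums over the complement in
large boxes. -/
theorem abs_sum_integral_mixedDiff_sub_le (hS : S.SquareIntegrable μ sch β)
    (hv : S.IsSampler μ sch β vphi) {l : ℝ} (hl : S.Consistent μ sch β l) {c : ℝ} (hc : 0 ≤ c)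
    (h1 : ∀ α : ℕ × ℕ, |∫ ω, S.mixedDiff sch β vphi α ω ∂(Measure.pi fun _ => μ)|
      ≤ c * rate β (-1) (-1) α) {A B L δ : ℝ} (hA : 1 ≤ A) (hB : 1 ≤ B)
    (hδ : ∀ n, ∑ α ∈ boxGt A B L n, rate β (-1) (-1) α ≤ δ) :
    |∑ α ∈ levelFinset A B L, ∫ ω, S.mixedDiff sch β vphi α ω ∂(Measure.pi fun _ => μ) - l|
      ≤ c * δ := by
  set e : ℕ × ℕ → ℝ := fun α => ∫ ω, S.mixedDiff sch β vphi α ω ∂(Measure.pi fun _ => μ) with he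
  have hdiag : Tendsto (fun n : ℕ => (n, n)) atTop (atTop : Filter (ℕ × ℕ)) := by
    rw [← prod_atTop_atTop_eq]
    exact tendsto_id.prodMk tendsto_id
  have hlim : Tendsto (fun n : ℕ => |∑ α ∈ levelFinset A B L, e α -
      ∫ ω, S.phi sch (β ^ n) (β ^ n) ω ∂(Measure.pi fun _ => μ)|) atTop
      (𝓝 |∑ α ∈ levelFinset A B L, e α - l|) :=
    (tendsto_const_nhds.sub (hl.comp hdiag)).abs
  refine le_of_tendsto hlim ?_
  filter_upwards [eventually_ge_atTop ⌊L⌋₊] with n hn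
  -- Both coefficients are at least `1`, so members have coordinates at most `⌊L⌋₊` and any larger
  -- box cuts out the same set.
  have hbox : levelFinset A B L = boxLe A B L (n + 1) := by
    ext α
    rw [mem_levelFinset hA hB]
    refine ⟨fun h => ?_, fun h => (mem_filter.1 h).2⟩
    have := (mem_levelFinset hA hB).2 h
    simp only [levelFinset, boxLe, mem_filter, mem_product, Finset.mem_range] at this ⊢
    exact ⟨⟨by omega, by omega⟩, h⟩
  have hsplit := sum_filter_add_sum_filter_not (range (n + 1) ×ˢ range (n + 1))
    (fun α : ℕ × ℕ => A * α.1 + B * α.2 ≤ L) e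
  rw [← sum_integral_mixedDiff hS hv n n, ← hsplit, hbox, boxLe, sub_add_cancel_left, abs_neg]
  calc _ ≤ ∑ α ∈ boxGt A B L (n + 1), |e α| := abs_sum_le_sum_abs _ _
    _ ≤ ∑ α ∈ boxGt A B L (n + 1), c * rate β (-1) (-1) α := sum_le_sum fun α _ => h1 α
    _ ≤ c * δ := by
      rw [← mul_sum]
      exact mul_le_mul_of_nonneg_left (hδ _) hc

/-- Each group picks distinct coordinates, hence sees `β ^ ℓ` i.i.d. inputs; the average of `β`
equal means is that mean. -/
theorem isSampler_partitioning (hβ : 2 ≤ β) (hS : S.SquareIntegrable μ sch β) :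
    S.IsSampler μ sch β (S.partitioning sch β) := by
  intro ℓ k
  have hmp : ∀ i : Fin β, MeasurePreserving
      (fun (ω : Fin (β ^ (ℓ + 1)) → Ω₀) (q : Fin (β ^ ℓ)) =>
        ω (Fin.cast (by rw [pow_succ, mul_comm]) (finProdFinEquiv (i, q))))
      (Measure.pi fun _ => μ) (Measure.pi fun _ => μ) := fun i =>
    measurePreserving_pi_comp (fun p q h => by
      have := finProdFinEquiv.injective (Fin.cast_injective _ h)
      exact (Prod.mk.inj this).2)
  have hL2 : ∀ i : Fin β, MemLp (fun ω : Fin (β ^ (ℓ + 1)) → Ω₀ => S.phi sch (β ^ ℓ) (β ^ k)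
      fun q => ω (Fin.cast (by rw [pow_succ, mul_comm]) (finProdFinEquiv (i, q)))) 2
      (Measure.pi fun _ => μ) := fun i => (hS (ℓ, k)).comp_measurePreserving (hmp i)
  refine ⟨(memLp_finsetSum univ fun i _ => hL2 i).const_mul _, ?_⟩
  have heq := fun i => by
    have h := integral_map (hmp i).aemeasurable (f := S.phi sch (β ^ ℓ) (β ^ k))
      (by rw [(hmp i).map_eq]; exact (hS (ℓ, k)).1)
    rw [(hmp i).map_eq] at h
    exact h.symm
  have hb : (β : ℝ) ≠ 0 := by exact_mod_cast (by omega : β ≠ 0)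
  unfold partitioning
  rw [integral_const_mul, integral_finsetSum _ fun i _ => (hL2 i).integrable one_le_two]
  simp only [heq, sum_const, card_univ, Fintype.card_fin, nsmul_eq_mul]
  field_simp

end ParticleSystem

/-! ### The exponents in terms of the coefficients of the index set. -/

theorem two_mul_max_zetaExp (γP sP sN : ℝ) :
    2 * max 0 (zetaExp γP sP sN) = max 0 (max (1 - sP + γP) (3 - sN) - 2) := by
  rw [← max_sub_sub_right, zetaExp, mul_max_of_nonneg _ _ zero_le_two,
    mul_max_of_nonneg _ _ zero_le_two]
  congr 2 <;> ring

theorem max_eq_two_mul_zetaExp_add (γP sP sN : ℝ) :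
    max (1 - sP + γP) (3 - sN) = 2 * zetaExp γP sP sN + 2 := by
  rw [zetaExp, mul_max_of_nonneg _ _ zero_le_two, ← max_add_add_right]
  congr 1 <;> ring

theorem zExp_cases (γP sP sN : ℝ) :
    1 - sP + γP = 3 - sN ∧ zExp γP sP sN - 1 = 1 ∨ 1 - sP + γP ≠ 3 - sN ∧ zExp γP sP sN - 1 = 0 := by
  have h : 1 - sP + γP = 3 - sN ↔ γP - sP - 1 = 1 - sN := by constructor <;> intro h <;> linarith
  rw [zExp, ne_eq, h]
  split_ifs with h'
  · exact Or.inl ⟨h', by norm_num⟩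
  · exact Or.inr ⟨h', sub_self _⟩

/-- The sign of `ζ` is that of `max A B - 2`. As `(2 - sP) / γP > 0`, the condition `ξ > 0` reduces
to `sN < 2`, that is `B > 1`. -/
theorem pExp_cases {γP sP sN : ℝ} (hγ : 1 ≤ γP) (hP : sP ≤ 1) :
    max (1 - sP + γP) (3 - sN) < 2 ∧ pExp γP sP sN = 0 ∨
    max (1 - sP + γP) (3 - sN) = 2 ∧ pExp γP sP sN = 2 * (zExp γP sP sN - 1 + 1) ∨
    2 < max (1 - sP + γP) (3 - sN) ∧
      (1 < 3 - sN ∧ pExp γP sP sN = (zExp γP sP sN - 1) * max (1 - sP + γP) (3 - sN) ∨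
        pExp γP sP sN = 1 + (zExp γP sP sN - 1) * max (1 - sP + γP) (3 - sN)) := by
  rw [max_eq_two_mul_zetaExp_add, pExp]
  have h0 : 0 < (2 - sP) / γP := div_pos (by linarith) (by linarith)
  have hxi : 0 < xiExp γP sP sN ↔ 1 < 3 - sN := by
    rw [xiExp, lt_min_iff]
    exact ⟨fun h => by linarith [h.2], fun h => ⟨h0, by linarith⟩⟩
  split_ifs with h1 h2 h3
  · exact Or.inl ⟨by linarith, rfl⟩
  · exact Or.inr (Or.inl ⟨by linarith, by ring⟩)
  · refine Or.inr (Or.inr ⟨?_, Or.inl ⟨hxi.1 h3, by ring⟩⟩)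
    have := lt_of_le_of_ne (not_lt.1 h1) (Ne.symm h2)
    linarith
  · refine Or.inr (Or.inr ⟨?_, Or.inr (by ring)⟩)
    have := lt_of_le_of_ne (not_lt.1 h1) (Ne.symm h2)
    linarith

/-- Sample numbers with prescribed variance `v`. -/
theorem exists_sample_numbers {var work s m : ℕ × ℕ → ℝ} (hm : ∀ α, 0 < m α)
    (hs : ∀ α, 0 < s α) {c₂ c₃ v : ℝ} (hc₂ : 0 < c₂) (hv : 0 < v)
    (hvar : ∀ α, var α ≤ c₂ * (s α * m α)) {w : ℕ × ℕ → ℝ} (hw : ∀ α, m α * w α = s α)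
    (hwork : ∀ α, work α ≤ c₃ * w α) {I : Finset (ℕ × ℕ)} (hI : I.Nonempty) :
    ∃ M : ℕ × ℕ → ℕ, (∀ α ∈ I, 0 < M α) ∧ ∑ α ∈ I, var α / M α ≤ v ∧
      (0 ≤ c₃ → ∑ α ∈ I, (M α : ℝ) * work α
        ≤ c₂ * c₃ * ((∑ α ∈ I, s α) ^ 2 / v) + c₃ * ∑ α ∈ I, w α) := by
  set SI := ∑ α ∈ I, s α with hSI
  have hSI0 : 0 < SI := sum_pos (fun α _ => hs α) hI
  have hQ : 0 < c₂ * SI / v := by positivity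
  have hM : ∀ α, 0 < ⌈c₂ * SI / v * m α⌉₊ := fun α => Nat.ceil_pos.2 (mul_pos hQ (hm α))
  -- The optimal real sample numbers, rounded up. Rounding can only lower the variance and adds at
  -- most one sample per index, which produces the sum of `w`.
  refine ⟨fun α => ⌈c₂ * SI / v * m α⌉₊, fun α _ => hM α, ?_, fun hc₃ => ?_⟩
  · calc _ ≤ ∑ α ∈ I, s α * (v / SI) := ?_
      _ = v := by rw [← sum_mul, ← hSI]; field_simp
    refine sum_le_sum fun α _ => ?_
    have h1 := hm α
    have h2 := hs α
    calc _ ≤ c₂ * (s α * m α) / (⌈c₂ * SI / v * m α⌉₊ : ℝ) := by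
          gcongr
          exact hvar α
      _ ≤ c₂ * (s α * m α) / (c₂ * SI / v * m α) := by
          gcongr
          exact Nat.le_ceil _
      _ = _ := by field_simp
  · calc _ ≤ ∑ α ∈ I, (c₃ * (c₂ * SI / v) * s α + c₃ * w α) := ?_
      _ = _ := by
        rw [sum_add_distrib, ← mul_sum, ← mul_sum, ← hSI]
        ring
    refine sum_le_sum fun α _ => ?_
    have h1 := hm α
    have hw0 : 0 < w α := pos_of_mul_pos_right ((hw α).symm ▸ hs α) h1.le
    calc _ ≤ (⌈c₂ * SI / v * m α⌉₊ : ℝ) * (c₃ * w α) := by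
          gcongr
          exact hwork α
      _ ≤ (c₂ * SI / v * m α + 1) * (c₃ * w α) := by
          gcongr
          exact (Nat.ceil_lt_add_one (mul_pos hQ h1).le).le
      _ = _ := by rw [← hw α]; ring

/-- Chebyshev's inequality, for the deviation from the mean and from a nearby value. -/
theorem measureReal_deviation_le {Ω : Type*} [MeasurableSpace Ω] {Pr : Measure Ω}
    [IsProbabilityMeasure Pr] {f : Ω → ℝ} (hf : MemLp f 2 Pr) {l tol θ ε : ℝ} (hθ : 0 < θ * tol)
    (hε : 0 ≤ ε) (hvar : variance f Pr ≤ ε * (θ * tol) ^ 2)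
    (hbias : |∫ w, f w ∂Pr - l| ≤ (1 - θ) * tol) :
    Pr.real {w | θ * tol ≤ |f w - ∫ w', f w' ∂Pr|} ≤ ε ∧ Pr.real {w | tol ≤ |f w - l|} ≤ ε := by
  have h1 : Pr.real {w | θ * tol ≤ |f w - ∫ w', f w' ∂Pr|} ≤ ε := by
    refine ENNReal.toReal_le_of_le_ofReal hε ((meas_ge_le_variance_div_sq hf hθ).trans ?_)
    refine ENNReal.ofReal_le_ofReal ?_
    rw [div_le_iff₀ (by positivity)]
    exact hvar
  refine ⟨h1, le_trans (measureReal_mono fun w hw => ?_) h1⟩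
  simp only [Set.mem_ofPred_eq] at hw ⊢
  have := abs_sub_le (f w) (∫ w', f w' ∂Pr) l
  linarith

theorem ParticleSystem.hasComplexity {d : ℕ} {Θ Ω₀ Ω : Type*} [MeasurableSpace Ω₀]
    [MeasurableSpace Ω] {S : ParticleSystem d Θ Ω₀} {μ : Measure Ω₀} [IsProbabilityMeasure μ]
    {Pr : Measure Ω} [IsProbabilityMeasure Pr] {smp : (ℕ × ℕ) × ℕ × ℕ → Ω → Ω₀}
    (hm : ∀ i, Measurable (smp i)) (hlaw : ∀ i, Pr.map (smp i) = μ) (hind : iIndepFun smp Pr)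
    {β : ℕ} (hβ : 2 ≤ β) {γP sP sN : ℝ} (hγ : 1 ≤ γP) (hP : sP ≤ 1) (hN : sN ≤ 2) {l : ℝ}
    {sch : Scheme d Ω₀} {vphi : Sampler β Ω₀} {work : ℕ × ℕ → ℝ}
    (hS : S.SquareIntegrable μ sch β) (hl : S.Consistent μ sch β l)
    (hv : S.IsSampler μ sch β vphi) (h1 : S.MIMC1 μ sch β vphi) (h2 : S.MIMC2 μ sch β vphi sP sN)
    (hwork : ∃ c : ℝ, ∀ α, work α ≤ c * rate β γP 1 α) :
    HasComplexity Pr smp (S.mixedDiff sch β vphi) work l (indexSet γP sP sN)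
      (2 + 2 * max 0 (zetaExp γP sP sN)) (pExp γP sP sN) := by
  intro ε hε _ C hC θ₀ hθ₀
  have hA : 1 ≤ 1 - sP + γP := by linarith
  have hB : 1 ≤ 3 - sN := by linarith
  obtain ⟨c₁, hc₁, h1⟩ : ∃ c : ℝ, 0 < c ∧ ∀ α : ℕ × ℕ,
      |∫ ω, S.mixedDiff sch β vphi α ω ∂(Measure.pi fun _ => μ)| ≤ c * rate β (-1) (-1) α := by
    obtain ⟨c, h⟩ := h1
    refine ⟨max c 1, by positivity, fun α => (h α).trans ?_⟩
    exact mul_le_mul_of_nonneg_right (le_max_left _ _) (rate_pos hβ _ _ _).le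
  obtain ⟨c₂, hc₂, h2⟩ : ∃ c : ℝ, 0 < c ∧ ∀ α : ℕ × ℕ,
      variance (S.mixedDiff sch β vphi α) (Measure.pi fun _ => μ)
        ≤ c * rate β (-sP - 1) (-sN) α := by
    obtain ⟨c, h⟩ := h2
    refine ⟨max c 1, by positivity, fun α => (h α).trans ?_⟩
    exact mul_le_mul_of_nonneg_right (le_max_left _ _) (rate_pos hβ _ _ _).le
  obtain ⟨c₃, hc₃, hwork⟩ : ∃ c : ℝ, 0 < c ∧ ∀ α : ℕ × ℕ, work α ≤ c * rate β γP 1 α := by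
    obtain ⟨c, h⟩ := hwork
    refine ⟨max c 1, by positivity, fun α => (h α).trans ?_⟩
    exact mul_le_mul_of_nonneg_right (le_max_left _ _) (rate_pos hβ _ _ _).le
  -- With `δ = θ₀ / c₁` the bias is at most `θ₀ tol`, and `θ₀ ≤ 1 - θ`.
  obtain ⟨K, hK, hlevel⟩ := exists_level_work hβ hA hB (show γP ≤ 1 - sP + γP by linarith)
    (zExp_cases γP sP sN) (pExp_cases hγ hP) (div_pos hθ₀ hc₁)
  set A := 1 - sP + γP with hAdef
  set B := 3 - sN with hBdef
  -- The prescribed `C` need not be large enough for Chebyshev's inequality to give probability `ε`;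
  -- the larger constant serves both requirements.
  set C' := max C (√ε)⁻¹ with hC'def
  have hC' : 0 < C' := lt_max_of_lt_left hC
  have hεC : C'⁻¹ ^ 2 ≤ ε := by
    have : C'⁻¹ ≤ √ε := inv_le_of_inv_le₀ (Real.sqrt_pos.2 hε) (le_max_right _ _)
    calc C'⁻¹ ^ 2 ≤ √ε ^ 2 := by gcongr
      _ = ε := Real.sq_sqrt hε.le
  refine ⟨c₂ * c₃ * K * (C' / θ₀) ^ 2 + c₃ * K, fun tol htol htol1 θ hθ hθ1 => ?_⟩
  have hℓ : 1 ≤ Real.log tol⁻¹ := by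
    rw [Real.log_inv]
    have := Real.log_lt_log htol htol1
    rw [Real.log_exp] at this
    linarith
  set ℓ := Real.log tol⁻¹ with hℓdef
  have htolexp : ∀ x : ℝ, tol ^ x = Real.exp (-x * ℓ) := fun x => by
    rw [Real.rpow_def_of_pos htol, hℓdef, Real.log_inv]
    congr 1
    ring
  have htol_eq : Real.exp (-ℓ) = tol := by
    rw [hℓdef, Real.log_inv, neg_neg, Real.exp_log htol]
  obtain ⟨L, hL, hT, hSI, hW⟩ := hlevel ℓ hℓ
  have hθ0 : 0 < θ := hθ₀.trans_le hθ
  have hvv : 0 < (θ * tol / C') ^ 2 := by positivity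
  have hI : (levelFinset A B L).Nonempty :=
    ⟨(0, 0), (mem_levelFinset hA hB).2 (by simpa using hL.le)⟩
  obtain ⟨M, hM, hMvar, hMwork⟩ := exists_sample_numbers
    (var := fun α => variance (S.mixedDiff sch β vphi α) (Measure.pi fun _ => μ)) (work := work)
    -- In terms of the rates, `s = √(var · work)` and `m = √(var / work)`, so `s m` is the variance
    -- rate and `m w = s`.
    (s := rate β ((A - 2) / 2) ((B - 2) / 2)) (m := rate β ((-sP - 1 - γP) / 2) ((-sN - 1) / 2))
    (w := rate β γP 1) (rate_pos hβ _ _) (rate_pos hβ _ _) hc₂ hvv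
    (fun α => by
      rw [rate_mul hβ]
      convert h2 α using 3 <;> ring)
    (fun α => by
      rw [rate_mul hβ]
      congr 1 <;> ring)
    hwork hI
  have hΔ := memLp_mixedDiff hS hv
  have hmem := memLp_estimator hm hlaw hind hΔ (levelFinset A B L) M
  have hvar : variance (estimator (S.mixedDiff sch β vphi) smp (levelFinset A B L) M) Pr
      ≤ (θ * tol / C') ^ 2 := by
    rw [variance_estimator hm hlaw hind hΔ _ hM]
    exact hMvar
  have hbias : |∫ w, estimator (S.mixedDiff sch β vphi) smp (levelFinset A B L) M w ∂Pr - l|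
      ≤ (1 - θ) * tol := by
    rw [integral_estimator hm hlaw hind hΔ _ hM]
    refine (abs_sum_integral_mixedDiff_sub_le hS hv hl hc₁.le h1 hA hB hT).trans ?_
    rw [htol_eq, ← mul_assoc, mul_div_cancel₀ _ hc₁.ne']
    gcongr
    linarith
  have hdev := measureReal_deviation_le hmem (mul_pos hθ0 htol) hε.le (hvar.trans (by
    rw [div_eq_mul_inv, mul_pow, mul_comm]
    gcongr)) hbias
  refine ⟨L, hL, levelFinset A B L, coe_levelFinset hA hB, M, hM, hmem, hbias, ?_, hdev.1, hdev.2,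
    (hMwork hc₃.le).trans ?_⟩
  · refine hvar.trans ?_
    gcongr
    exact le_max_left _ _
  · rw [two_mul_max_zetaExp, htolexp, neg_neg]
    have hsq : (∑ α ∈ levelFinset A B L, rate β ((A - 2) / 2) ((B - 2) / 2) α) ^ 2
        / (θ * tol / C') ^ 2
        ≤ K * (C' / θ₀) ^ 2 * Real.exp ((2 + max 0 (max A B - 2)) * ℓ) * ℓ ^ pExp γP sP sN := by
      calc _ ≤ K * Real.exp (max 0 (max A B - 2) * ℓ) * ℓ ^ pExp γP sP sN
            / (θ₀ * tol / C') ^ 2 := by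
            gcongr
            exact hSI _
        _ = K * (C' / θ₀) ^ 2 * (Real.exp (2 * ℓ) * Real.exp (max 0 (max A B - 2) * ℓ))
            * ℓ ^ pExp γP sP sN := by
            have : Real.exp (2 * ℓ) = tol⁻¹ ^ 2 := by
              rw [← htol_eq, ← Real.exp_neg, neg_neg, ← Real.exp_nat_mul]
              norm_num
            rw [this]
            field_simp
        _ = _ := by rw [← Real.exp_add, ← add_mul]
    calc _ ≤ c₂ * c₃ * (K * (C' / θ₀) ^ 2 * Real.exp ((2 + max 0 (max A B - 2)) * ℓ)
            * ℓ ^ pExp γP sP sN)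
          + c₃ * (K * Real.exp ((2 + max 0 (max A B - 2)) * ℓ) * ℓ ^ pExp γP sP sN) := by
          gcongr
          exact hW _
      _ = _ := by ring

/-- With the naive cost of a particle system, the work of the partitioning sampler is
quadratic in the number of particles. -/
theorem IsNaiveCost.partitioningWork_le {β : ℕ} (hβ : 2 ≤ β) {cost : ℕ → ℕ → ℝ}
    (h : IsNaiveCost cost) : ∃ c : ℝ, ∀ α, partitioningWork β cost α ≤ c * rate β 2 1 α := by
  obtain ⟨κ, hκ⟩ := h
  have hb : (1 : ℝ) ≤ β := by exact_mod_cast (by omega : 1 ≤ β)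
  have hb0 : (0 : ℝ) < β := by linarith
  have hpos : ∀ k, 1 ≤ β ^ k := fun k => Nat.one_le_pow _ _ (by omega)
  have hκ0 : 0 ≤ κ := by simpa using (hκ 1 1 le_rfl le_rfl).1.trans (hκ 1 1 le_rfl le_rfl).2
  have hcost : ∀ i k, cost (β ^ i) (β ^ k) ≤ κ * ((β : ℝ) ^ k * ((β : ℝ) ^ i) ^ 2) :=
    fun i k => by simpa using (hκ (β ^ i) (β ^ k) (hpos i) (hpos k)).2
  have hlevel : ∀ k i, levelWork β cost (β ^ k) i
      ≤ 2 * κ * ((β : ℝ) ^ k * ((β : ℝ) ^ i) ^ 2) := by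
    intro k i
    cases i with
    | zero =>
      have h1 := hcost 0 k
      have : 0 ≤ κ * ((β : ℝ) ^ k * ((β : ℝ) ^ 0) ^ 2) := by positivity
      simp only [levelWork]
      linarith
    | succ i =>
      have h1 := hcost (i + 1) k
      have h2 : (β : ℝ) * cost (β ^ i) (β ^ k)
          ≤ κ * ((β : ℝ) ^ k * ((β : ℝ) ^ (i + 1)) ^ 2) := by
        calc _ ≤ (β : ℝ) * (κ * ((β : ℝ) ^ k * ((β : ℝ) ^ i) ^ 2)) := by gcongr; exact hcost i k
          -- At quadratic cost the `β` groups together cost a factor `β` less than the full system;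
          -- this gain is given away.
          _ ≤ (β : ℝ) * (β * (κ * ((β : ℝ) ^ k * ((β : ℝ) ^ i) ^ 2))) := by
            refine mul_le_mul_of_nonneg_left ?_ hb0.le
            exact le_mul_of_one_le_left (by positivity) hb
          _ = _ := by ring
      simp only [levelWork]
      linarith
  have hrate : ∀ i k : ℕ, rate β 2 1 (i, k) = (β : ℝ) ^ k * ((β : ℝ) ^ i) ^ 2 := fun i k => by
    simp only [rate, Real.rpow_one, Real.rpow_two]
    ring
  refine ⟨4 * κ, fun ⟨i, k⟩ => ?_⟩
  rw [hrate]
  cases k with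
  | zero =>
    have h1 := hlevel 0 i
    have : 0 ≤ κ * ((β : ℝ) ^ 0 * ((β : ℝ) ^ i) ^ 2) := by positivity
    simp only [partitioningWork]
    linarith
  | succ k =>
    have h1 := hlevel (k + 1) i
    have h2 := hlevel k i
    have h3 : κ * ((β : ℝ) ^ k * ((β : ℝ) ^ i) ^ 2)
        ≤ κ * ((β : ℝ) ^ (k + 1) * ((β : ℝ) ^ i) ^ 2) := by
      gcongr
      omega
    simp only [partitioningWork]
    linarith

end MIMC

theorem mainTheorem6 {d : ℕ} {Θ Ω₀ Ω Ω' : Type*}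
    [MeasurableSpace Θ] [MeasurableSpace Ω₀] [MeasurableSpace Ω] [MeasurableSpace Ω']
    -- the particle system, and the law of the random inputs of one particle
    (S : MIMC.ParticleSystem d Θ Ω₀) (μ : Measure Ω₀) [IsProbabilityMeasure μ]
    (hS : S.IsAdmissible μ)
    -- the mean-field limit, and the target value `φ_∞ = E[ψ(X_∞(T))]`
    (P' : Measure Ω') [IsProbabilityMeasure P'] (X : ℝ≥0 → Ω' → MIMC.Vec d) (ξ : Ω' → Θ)
    (hX : S.IsMeanFieldLimit μ P' X ξ)
    (hψ : Integrable (fun w => S.qoi (X S.horizon w)) P')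
    (φlim : ℝ) (hφlim : φlim = ∫ w, S.qoi (X S.horizon w) ∂P')
    -- independent samples of the random inputs
    (Pr : Measure Ω) [IsProbabilityMeasure Pr] (smp : (ℕ × ℕ) × ℕ × ℕ → Ω → Ω₀)
    (hsmp_meas : ∀ i, Measurable (smp i)) (hsmp_law : ∀ i, Pr.map (smp i) = μ)
    (hsmp_indep : iIndepFun smp Pr)
    (β : ℕ) (hβ : 2 ≤ β) :
    -- general rates
    (∀ γP sP sN : ℝ, 1 ≤ γP → 0 ≤ sP → sP ≤ 1 → 0 < sN → sN ≤ 2 →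
      -- the optimal index set
      (∀ c₁ c₂ c₃ : ℝ, 0 < c₁ → 0 < c₂ → 0 < c₃ → ∀ L : ℝ, 0 < L →
        MIMC.IsOptimalIndexSet (fun α => c₁ * MIMC.rate β (-1) (-1) α)
          (fun α => c₂ * MIMC.rate β (-sP - 1) (-sN) α) (fun α => c₃ * MIMC.rate β γP 1 α)
          (MIMC.indexSet γP sP sN L)) ∧
      -- the complexity
      (∀ (sch : MIMC.Scheme d Ω₀) (vphi : MIMC.Sampler β Ω₀) (work : ℕ × ℕ → ℝ),
        S.SquareIntegrable μ sch β → S.Consistent μ sch β φlim → S.IsSampler μ sch β vphi →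
        S.MIMC1 μ sch β vphi → S.MIMC2 μ sch β vphi sP sN →
        (∃ c : ℝ, ∀ α, 0 ≤ work α ∧ work α ≤ c * MIMC.rate β γP 1 α) →
        MIMC.HasComplexity Pr smp (S.mixedDiff sch β vphi) work φlim (MIMC.indexSet γP sP sN)
          (2 + 2 * max 0 (MIMC.zetaExp γP sP sN)) (MIMC.pExp γP sP sN))) ∧
    -- naive cost, partitioning sampler, Milstein
    (∀ cost : ℕ → ℕ → ℝ, MIMC.IsNaiveCost cost →
      S.SquareIntegrable μ S.milstein β → S.Consistent μ S.milstein β φlim →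
      S.MIMC1 μ S.milstein β (S.partitioning S.milstein β) →
      S.MIMC2 μ S.milstein β (S.partitioning S.milstein β) 1 2 →
      MIMC.HasComplexity Pr smp (S.mixedDiff S.milstein β (S.partitioning S.milstein β))
        (MIMC.partitioningWork β cost) φlim (MIMC.indexSet 2 1 2) 2 2) ∧
    -- naive cost, partitioning sampler, Euler-Maruyama
    (∀ cost : ℕ → ℕ → ℝ, MIMC.IsNaiveCost cost →
      S.SquareIntegrable μ S.eulerMaruyama β → S.Consistent μ S.eulerMaruyama β φlim →
      S.MIMC1 μ S.eulerMaruyama β (S.partitioning S.eulerMaruyama β) →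
      S.MIMC2 μ S.eulerMaruyama β (S.partitioning S.eulerMaruyama β) 1 1 →
      MIMC.HasComplexity Pr smp (S.mixedDiff S.eulerMaruyama β (S.partitioning S.eulerMaruyama β))
        (MIMC.partitioningWork β cost) φlim (MIMC.indexSet 2 1 1) 2 4) := by
  refine ⟨fun γP sP sN hγ hP0 hP1 hN0 hN2 => ⟨fun c₁ c₂ c₃ h₁ h₂ h₃ L hL =>
    MIMC.isOptimalIndexSet_indexSet hβ (by linarith) (by linarith) h₁ h₂ h₃ hL,
    fun sch vphi work hsq hcons hv h1 h2 hwork => MIMC.ParticleSystem.hasComplexity hsmp_meas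
      hsmp_law hsmp_indep hβ hγ hP1 hN2 hsq hcons hv h1 h2
      (hwork.imp fun c hc α => (hc α).2)⟩,
    fun cost hcost hsq hcons h1 h2 => ?_, fun cost hcost hsq hcons h1 h2 => ?_⟩
  · have h := MIMC.ParticleSystem.hasComplexity hsmp_meas hsmp_law hsmp_indep hβ (γP := 2)
      one_le_two le_rfl le_rfl hsq hcons (MIMC.ParticleSystem.isSampler_partitioning hβ hsq) h1 h2
      (hcost.partitioningWork_le hβ)
    -- Here `A = 2` and `B = 1`: the critical value `2` is attained by the particle direction alone,
    -- which gives the power `2` of the logarithm.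
    have hζ : MIMC.zetaExp 2 1 2 = 0 := by norm_num [MIMC.zetaExp]
    have hz : MIMC.zExp 2 1 2 = 1 := by norm_num [MIMC.zExp]
    have hp : MIMC.pExp 2 1 2 = 2 := by simp [MIMC.pExp, hζ, hz]
    simpa [hζ, hp] using h
  · have h := MIMC.ParticleSystem.hasComplexity hsmp_meas hsmp_law hsmp_indep hβ (γP := 2)
      one_le_two le_rfl one_le_two hsq hcons
      (MIMC.ParticleSystem.isSampler_partitioning hβ hsq) h1 h2 (hcost.partitioningWork_le hβ)
    -- Here `A = B = 2`: both directions are critical, which doubles the power.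
    have hζ : MIMC.zetaExp 2 1 1 = 0 := by norm_num [MIMC.zetaExp]
    have hz : MIMC.zExp 2 1 1 = 2 := by norm_num [MIMC.zExp]
    have hp : MIMC.pExp 2 1 1 = 4 := by norm_num [MIMC.pExp, hζ, hz]
    simpa [hζ, hp] using h
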